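/- **Definitions.** A $k$-cell in $\mathbb R^k$ ($k\ge 1$) is a nonempty bounded finite intersection of open half spaces; an (oriented) $k$-cell in $\mathbb R^n$ is a $k$-cell in an oriented affine $k$-plane of $\mathbb R^n$; a $0$-cell is a point. Let $\mathbf P_k$ be the group of integral polyhedral $k$-chains in $\mathbb R^n$: finite formal sums $\sum a_i\sigma_i$ of $k$-cells, $a_i\in\mathbb Z$, two sums being identified if all smooth differential $k$-forms have the same integrals over them; $[S]$ denotes the class of $S$. Let $\partial$ be the usual boundary operator (sum of the facets, oriented by "outward normal first"; $\partial=0$ on $0$-chains), $M(\sigma)$ the $k$-dimensional measure of $\sigma$ (equal to $1$ for a point), and $M(P)=\sum|a_i|M(\sigma_i)$ for $P=[\sum a_i\sigma_i]$ with non-overlapping $\sigma_i$ (equivalently, the minimum of this sum over all representatives of $P$). Let $T_v$ denote translation by $v$. A $2^j$-multicell generated by a cell $\sigma^0$ and vectors $v_1,\dots,v_j$ is the chain $\sigma^j$ defined by $\sigma^i=\sigma^{i-1}-T_{v_i}\sigma^{i-1}$; put $\|\sigma^j\|_j=M(\sigma^0)\|v_1\|\cdots\|v_j\|$, and $\|S^j\|_j=\sum|a_i|\,\|\sigma_i^j\|_j$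 for an integral formal sum $S^j=\sum a_i\sigma^j_i$ of $2^j$-multicells. The $r$-natural norms on $\mathbf P_k$ are $|P|^{\natural_0}=M(P)$ and, for $r\ge1$, $$|P|^{\natural_r}=\inf\Big\{\sum_{j=0}^r\|S^j\|_j+|C|^{\natural_{r-1}}\ :\ P=\sum_{j=0}^r[S^j]+\partial C,\ C\in\mathbf P_{k+1}\Big\}.$$ The completion $\mathbf N_k^r$ of $\mathbf P_k$ in $|\cdot|^{\natural_r}$ is the group of $k$-chainlets of class $N^r$. Since $|P|^{\natural_{r+1}}\le|P|^{\natural_r}$ and $|\partial P|^{\natural_{r+1}}\le|P|^{\natural_r}$, there are a canonical map $\mathbf N_k^r\to\mathbf N_k^{r+1}$ and a continuous extension $\partial:\mathbf N_{k+1}^r\to\mathbf N_k^{r+1}$. For a $k$-cell $\tau$ and a vector $v$ let $\tau\times v$ be the orbit $\{x+tv: x\in\tau,\ 0<t<1\}$, oriented, if $v$ is transverse to $\tau$, by $-v$ followed by the orientation of $\tau$ (that is, so that $\tau$ occurs with its own orientation in $\partial(\tau\times v)$); if $v$ is tangent to $\tau$, the orbit is degenerate and $\tau\times v=0$. **Theorem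 (Geometric Cartan's magic formula).** Let $n,k\ge0$, let $\sigma$ be a $k$-cell in $\mathbb R^n$ and $v\in\mathbb R^n$ a vector. 1. For every cell $\tau$ in $\mathbb R^n$, of any dimension $l$, the sequence $2^j(\tau\times 2^{-j}v)$ converges in the $1$-natural norm to a chainlet $\mu_v\tau\in\mathbf N_{l+1}^1$. Extend $\mu_v$ additively to formal sums of cells. 2. The sequence $2^j(\sigma-T_{2^{-j}v}\sigma)$ converges in the $2$-natural norm to a chainlet $\mathcal L_v\sigma\in\mathbf N_k^2$. 3. In $\mathbf N_k^2$, $$\mathcal L_v\sigma=\mu_v\partial\sigma+\partial\mu_v\sigma .$$ -/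

import Mathlib

open scoped RealInnerProductSpace

noncomputable section

namespace Chainlets

/-- Euclidean space `ℝⁿ`. -/
abbrev E (n : ℕ) := EuclideanSpace ℝ (Fin n)

/-! ### Cells -/

/-- A `k`-cell in `ℝᵏ`: a finite intersection of open half spaces, nonempty and bounded
(i.e. of finite volume). For `k = 0` there are no half spaces and the only cell is the point. -/
def IsOpenCell {k : ℕ} (U : Set (E k)) : Prop :=
  (∃ H : Finset (E k × ℝ), (∀ h ∈ H, h.1 ≠ 0) ∧ U = {x | ∀ h ∈ H, ⟪h.1, x⟫ < h.2}) ∧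
    U.Nonempty ∧ Bornology.IsBounded U

/-- An oriented `k`-cell in `ℝⁿ`: a `k`-cell inside the `k`-plane through `base` that is spanned by
the orthonormal family `frame`. The orientation is the one in which `frame` is positive.
Presentations of the same oriented cell by different base points or frames are
identified in `PolyChain` below. -/
structure Cell (n k : ℕ) where
  base : E n
  frame : Fin k → E n
  orthonormal : Orthonormal ℝ frame
  region : Set (E k)
  isOpenCell : IsOpenCell region

namespace Cell

variable {n k : ℕ}

/-- The isometric parametrization of the plane of the cell. -/
def param (σ : Cell n k) (t : E k) : E n := σ.base + ∑ i, t i • σ.frame i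

/-- The cell as a subset of `ℝⁿ`. -/
def carrier (σ : Cell n k) : Set (E n) := σ.param '' σ.region

/-- The `k`-dimensional measure `M(σ)`, normalized to be Lebesgue measure on `k`-planes.
It is `1` for `k = 0`. -/
def mass (σ : Cell n k) : ℝ := (MeasureTheory.volume σ.region).toReal

/-- The integral of a differential `k`-form over an oriented `k`-cell. -/
def integral (σ : Cell n k) (ω : E n → E n [⋀^Fin k]→L[ℝ] ℝ) : ℝ :=
  ∫ t in σ.region, ω (σ.param t) σ.frame

/-- The translate `T_v σ`. -/
def translate (v : E n) (σ : Cell n k) : Cell n k := { σ with base := σ.base + v }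

end Cell

/-! ### Polyhedral chains -/

/-- Formal sums of oriented `k`-cells with integer coefficients. -/
abbrev FormalChain (n k : ℕ) := Cell n k →₀ ℤ

section chains

variable {n k : ℕ}

/-- A cell as a formal sum. -/
def single (σ : Cell n k) : FormalChain n k := Finsupp.single σ 1

/-- Additive extension to formal sums of a map defined on generators. -/
def linearize {α A : Type*} [AddCommGroup A] (f : α → A) : (α →₀ ℤ) →+ A :=
  Finsupp.liftAddHom fun a => (zmultiplesHom A) (f a)

/-- Integration of a form over formal sums of cells. -/
def formalIntegral (ω : E n → E n [⋀^Fin k]→L[ℝ] ℝ) : FormalChain n k →+ ℝ :=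
  linearize fun σ => σ.integral ω

variable (n k) in
/-- The formal sums over which all smooth `k`-forms integrate to `0`. -/
def nullChains : AddSubgroup (FormalChain n k) where
  carrier := {S | ∀ ω : E n → E n [⋀^Fin k]→L[ℝ] ℝ, ContDiff ℝ ((⊤ : ℕ∞) : WithTop ℕ∞) ω →
      formalIntegral ω S = 0}
  zero_mem' := by intro ω _; simp
  add_mem' := by
    intro a b ha hb ω hω
    rw [map_add, ha ω hω, hb ω hω, add_zero]
  neg_mem' := by
    intro a ha ω hω
    rw [map_neg, ha ω hω, neg_zero]

variable (n k) in
/-- The group `P_k(ℤ)` of integral polyhedral `k`-chains in `ℝⁿ`: formal sums of cells, two of them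
being equivalent if all smooth forms have the same integrals over them. -/
abbrev PolyChain := FormalChain n k ⧸ nullChains n k

/-- The polyhedral chain `[S]` of a formal sum `S`. -/
def toPoly : FormalChain n k →+ PolyChain n k := QuotientAddGroup.mk' (nullChains n k)

/-- Translation of formal sums of cells. -/
def translateChain (v : E n) : FormalChain n k →+ FormalChain n k :=
  linearize fun σ => single (σ.translate v)

end chains

/-! ### The boundary of a cell -/

section boundary

variable {n k : ℕ}

/-- The sign `±1` comparing the orientations given by two frames of the same subspace, the first
of them orthonormal. -/
def relSign (e f : Fin k → E n) : ℤ :=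
  (SignType.sign (Matrix.of fun i j => ⟪e i, f j⟫).det : ℤ)

/-- `τ` presents the facet (codimension one face) of `σ` with outward unit normal `ν`,
with either orientation. -/
def IsFacet (σ : Cell n (k + 1)) (ν : E n) (τ : Cell n k) : Prop :=
  ν ∈ Submodule.span ℝ (Set.range σ.frame) ∧ ‖ν‖ = 1 ∧
    ∃ c : ℝ, (∀ x ∈ σ.carrier, ⟪ν, x⟫ < c) ∧
      closure τ.carrier = closure σ.carrier ∩ {x | ⟪ν, x⟫ = c}

/-- The outward unit normals (within the plane of `σ`) of the facets of `σ`. -/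
def facetNormals (σ : Cell n (k + 1)) : Set (E n) := {ν | ∃ τ : Cell n k, IsFacet σ ν τ}

/-- The facet of `σ` with a given outward normal, as some cell (with some orientation). -/
def facet (σ : Cell n (k + 1)) (ν : facetNormals σ) : Cell n k := ν.2.choose

/-- The boundary of a cell: the sum of its (finitely many) facets, each with the orientation
induced by "outward normal first". -/
def cellBoundary (σ : Cell n (k + 1)) : FormalChain n k :=
  ∑ᶠ ν : facetNormals σ,
    relSign σ.frame (Fin.cons (ν : E n) (facet σ ν).frame) • single (facet σ ν)

/-- The boundary operator on formal sums of cells. On `0`-chains the boundary is `0`. -/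
def boundary : FormalChain n (k + 1) →+ FormalChain n k := linearize cellBoundary

end boundary

/-! ### Multicells and their norms -/

section multicells

variable {n k : ℕ}

/-- A `2ʲ`-multicell, given by the cell `σ⁰` and the vectors `v₁, …, vⱼ` that generate it. -/
structure Multicell (n k j : ℕ) where
  cell : Cell n k
  vec : Fin j → E n

/-- The cellular chain `σʲ = σʲ⁻¹ - T_{vⱼ} σʲ⁻¹` of a multicell. -/
def multicellChain (σ : Cell n k) : {j : ℕ} → (Fin j → E n) → FormalChain n k
  | 0, _ => single σ
  | _ + 1, v => multicellChain σ (Fin.init v) -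
      translateChain (v (Fin.last _)) (multicellChain σ (Fin.init v))

/-- `‖σʲ‖_j = M(σ⁰) ‖v₁‖ ⋯ ‖vⱼ‖`. -/
def Multicell.norm {j : ℕ} (m : Multicell n k j) : ℝ := m.cell.mass * ∏ i, ‖m.vec i‖

/-- `2ʲ`-multicellular chains. -/
abbrev MultiChain (n k j : ℕ) := Multicell n k j →₀ ℤ

/-- `∑ |aᵢ| w(αᵢ)` for a formal sum `∑ aᵢ αᵢ`. -/
def weightedNorm {α : Type*} (w : α → ℝ) (S : α →₀ ℤ) : ℝ := S.sum fun a z => |(z : ℝ)| * w a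

/-- `‖Sʲ‖_j = ∑ |aᵢ| ‖σᵢʲ‖_j`. -/
def MultiChain.norm {j : ℕ} (S : MultiChain n k j) : ℝ := weightedNorm Multicell.norm S

/-- The polyhedral chain `[Sʲ]`. -/
def MultiChain.toPoly {j : ℕ} : MultiChain n k j →+ PolyChain n k :=
  Chainlets.toPoly.comp (linearize fun m => multicellChain m.cell m.vec)

end multicells

/-! ### Mass and the natural norms -/

section norms

variable {n : ℕ}

/-- The mass of a polyhedral chain: the least value of `∑ |aᵢ| M(σᵢ)` over the
representatives `∑ aᵢ σᵢ`. It is attained exactly when no cancellation takes place, in particular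
at every representative with non-overlapping cells. -/
def mass {k : ℕ} (P : PolyChain n k) : ℝ :=
  sInf {x | ∃ S : FormalChain n k, toPoly S = P ∧ x = weightedNorm Cell.mass S}

/-- The `r`-natural norm `|P|^{♮_r}`: the mass for `r = 0`, and for `r ≥ 1` the infimum of
`∑_{j ≤ r} ‖Sʲ‖_j + |C|^{♮_{r-1}}` over all decompositions `P = ∑_{j ≤ r} [Sʲ] + ∂C`, where the
polyhedral chain `C` is given by a formal sum representing it. -/
def natNorm : (r : ℕ) → {k : ℕ} → PolyChain n k → ℝ
  | 0, _, P => mass P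
  | r + 1, k, P =>
      sInf {x | ∃ (S : ∀ j : Fin (r + 2), MultiChain n k j) (C : FormalChain n (k + 1)),
        P = ∑ j, (S j).toPoly + toPoly (boundary C) ∧
        x = ∑ j, (S j).norm + natNorm r (toPoly C)}

/-! The natural norms are seminorms, decrease with `r`, and `∂` is bounded. -/

lemma weightedNorm_nonneg {α : Type*} {w : α → ℝ} (hw : ∀ a, 0 ≤ w a) (S : α →₀ ℤ) :
    0 ≤ weightedNorm w S :=
  Finset.sum_nonneg fun a _ => mul_nonneg (abs_nonneg _) (hw a)

@[simp] lemma weightedNorm_zero {α : Type*} (w : α → ℝ) : weightedNorm w 0 = 0 := by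
  simp [weightedNorm]

@[simp] lemma weightedNorm_neg {α : Type*} (w : α → ℝ) (S : α →₀ ℤ) :
    weightedNorm w (-S) = weightedNorm w S := by
  simp [weightedNorm, Finsupp.sum]

lemma weightedNorm_add_le {α : Type*} {w : α → ℝ} (hw : ∀ a, 0 ≤ w a) (S T : α →₀ ℤ) :
    weightedNorm w (S + T) ≤ weightedNorm w S + weightedNorm w T := by
  classical
  have key : ∀ R : α →₀ ℤ, R.support ⊆ S.support ∪ T.support →
      weightedNorm w R = ∑ a ∈ S.support ∪ T.support, |(R a : ℝ)| * w a := fun R hR =>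
    Finsupp.sum_of_support_subset _ hR _ (by simp)
  rw [key _ Finsupp.support_add, key S Finset.subset_union_left, key T Finset.subset_union_right,
    ← Finset.sum_add_distrib]
  refine Finset.sum_le_sum fun a _ => ?_
  rw [← add_mul]
  refine mul_le_mul_of_nonneg_right ?_ (hw a)
  rw [Finsupp.add_apply, Int.cast_add]
  exact abs_add_le _ _

lemma Cell.mass_nonneg {k : ℕ} (σ : Cell n k) : 0 ≤ σ.mass := ENNReal.toReal_nonneg

lemma Multicell.norm_nonneg {k j : ℕ} (m : Multicell n k j) : 0 ≤ m.norm :=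
  mul_nonneg m.cell.mass_nonneg (Finset.prod_nonneg fun _ _ => _root_.norm_nonneg _)

lemma MultiChain.norm_nonneg {k j : ℕ} (S : MultiChain n k j) : 0 ≤ S.norm :=
  weightedNorm_nonneg Multicell.norm_nonneg S

lemma toPoly_surjective {k : ℕ} : Function.Surjective (toPoly : FormalChain n k →+ _) :=
  QuotientAddGroup.mk'_surjective _

/-- A formal sum of cells as a multicellular chain without vectors. -/
def asMultiChain {k : ℕ} : FormalChain n k →+ MultiChain n k 0 :=
  linearize fun σ => Finsupp.single ⟨σ, Fin.elim0⟩ 1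

lemma asMultiChain_toPoly {k : ℕ} (S : FormalChain n k) :
    (asMultiChain S).toPoly = toPoly S := by
  have : (MultiChain.toPoly (n := n) (k := k) (j := 0)).comp asMultiChain = toPoly := by
    ext σ
    simp [MultiChain.toPoly, asMultiChain, linearize, multicellChain, single]
  exact DFunLike.congr_fun this S

lemma asMultiChain_norm {k : ℕ} (S : FormalChain n k) :
    (asMultiChain S).norm = weightedNorm Cell.mass S := by
  have inj : Function.Injective (fun σ : Cell n k => (⟨σ, Fin.elim0⟩ : Multicell n k 0)) :=
    fun a b h => by simpa using h
  have : asMultiChain S = Finsupp.mapDomain (fun σ => (⟨σ, Fin.elim0⟩ : Multicell n k 0)) S := by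
    simp only [asMultiChain, linearize, Finsupp.liftAddHom_apply, Finsupp.mapDomain]
    exact Finsupp.sum_congr fun a _ => by simp
  rw [this, MultiChain.norm, weightedNorm, Finsupp.sum_mapDomain_index_inj inj]
  simp [weightedNorm, Multicell.norm]

lemma mass_set_bddBelow {k : ℕ} (P : PolyChain n k) :
    BddBelow {x | ∃ S : FormalChain n k, toPoly S = P ∧ x = weightedNorm Cell.mass S} := by
  refine ⟨0, ?_⟩
  rintro x ⟨S, -, rfl⟩
  exact weightedNorm_nonneg Cell.mass_nonneg S

lemma mass_set_nonempty {k : ℕ} (P : PolyChain n k) :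
    {x | ∃ S : FormalChain n k, toPoly S = P ∧ x = weightedNorm Cell.mass S}.Nonempty := by
  obtain ⟨S, hS⟩ := toPoly_surjective P
  exact ⟨_, S, hS, rfl⟩

lemma natNorm_nonneg (r : ℕ) {k : ℕ} (P : PolyChain n k) : 0 ≤ natNorm r P := by
  induction r generalizing k with
  | zero =>
    refine Real.sInf_nonneg ?_
    rintro x ⟨S, -, rfl⟩
    exact weightedNorm_nonneg Cell.mass_nonneg S
  | succ r ih =>
    refine Real.sInf_nonneg ?_
    rintro x ⟨S, C, -, rfl⟩
    exact add_nonneg (Finset.sum_nonneg fun j _ => (S j).norm_nonneg) (ih _)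

lemma natNorm_succ_le {r k : ℕ} (S : ∀ j : Fin (r + 2), MultiChain n k j)
    (C : FormalChain n (k + 1)) (P : PolyChain n k)
    (h : P = ∑ j, (S j).toPoly + toPoly (boundary C)) :
    natNorm (r + 1) P ≤ ∑ j, (S j).norm + natNorm r (toPoly C) := by
  rw [natNorm]
  refine csInf_le ⟨0, ?_⟩ ⟨S, C, h, rfl⟩
  rintro x ⟨S, C, -, rfl⟩
  exact add_nonneg (Finset.sum_nonneg fun j _ => (S j).norm_nonneg) (natNorm_nonneg _ _)

/-- The family of multicellular chains `(S, 0, …, 0)`. -/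
def headSeq {k : ℕ} (r : ℕ) (S : FormalChain n k) (j : Fin (r + 2)) : MultiChain n k j :=
  Fin.cons (α := fun j : Fin (r + 2) => MultiChain n k j) (asMultiChain S) (fun _ => 0) j

lemma headSeq_toPoly {k : ℕ} (r : ℕ) (S : FormalChain n k) :
    ∑ j, (headSeq r S j).toPoly = toPoly S := by
  rw [Fin.sum_univ_succ]
  change (asMultiChain S).toPoly +
    ∑ i : Fin (r + 1), MultiChain.toPoly (0 : MultiChain n k (i.succ : Fin (r + 2))) = _
  simp [asMultiChain_toPoly]

lemma headSeq_norm {k : ℕ} (r : ℕ) (S : FormalChain n k) :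
    ∑ j, (headSeq r S j).norm = weightedNorm Cell.mass S := by
  rw [Fin.sum_univ_succ]
  change (asMultiChain S).norm +
    ∑ i : Fin (r + 1), MultiChain.norm (0 : MultiChain n k (i.succ : Fin (r + 2))) = _
  rw [asMultiChain_norm]
  simp [MultiChain.norm]

lemma natNorm_succ_le_mass {r k : ℕ} (S : FormalChain n k)
    (h0 : natNorm r (0 : PolyChain n (k + 1)) = 0) :
    natNorm (r + 1) (toPoly S) ≤ weightedNorm Cell.mass S := by
  have h := natNorm_succ_le (headSeq r S) 0 (toPoly S) (by rw [headSeq_toPoly]; simp)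
  rw [headSeq_norm, map_zero, h0, add_zero] at h
  exact h

lemma natNorm_zero (r : ℕ) {k : ℕ} : natNorm r (0 : PolyChain n k) = 0 := by
  refine le_antisymm ?_ (natNorm_nonneg _ _)
  induction r generalizing k with
  | zero => exact csInf_le (mass_set_bddBelow 0) ⟨0, by simp, by simp⟩
  | succ r ih =>
    simpa using natNorm_succ_le_mass (r := r) (0 : FormalChain n k)
      (le_antisymm ih (natNorm_nonneg _ _))

lemma natNorm_succ_set_nonempty {r k : ℕ} (P : PolyChain n k) :
    {x | ∃ (S : ∀ j : Fin (r + 2), MultiChain n k j) (C : FormalChain n (k + 1)),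
        P = ∑ j, (S j).toPoly + toPoly (boundary C) ∧
        x = ∑ j, (S j).norm + natNorm r (toPoly C)}.Nonempty := by
  obtain ⟨S, rfl⟩ := toPoly_surjective P
  exact ⟨_, headSeq r S, 0, by rw [headSeq_toPoly]; simp, rfl⟩

lemma natNorm_add_le (r : ℕ) {k : ℕ} (P Q : PolyChain n k) :
    natNorm r (P + Q) ≤ natNorm r P + natNorm r Q := by
  induction r generalizing k with
  | zero =>
    refine le_of_forall_pos_le_add fun ε hε => ?_
    obtain ⟨_, ⟨S, hS, rfl⟩, hSε⟩ := Real.lt_sInf_add_pos (mass_set_nonempty P) (half_pos hε)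
    obtain ⟨_, ⟨T, hT, rfl⟩, hTε⟩ := Real.lt_sInf_add_pos (mass_set_nonempty Q) (half_pos hε)
    have h1 : natNorm 0 (P + Q) ≤ weightedNorm Cell.mass (S + T) :=
      csInf_le (mass_set_bddBelow _) ⟨S + T, by rw [map_add, hS, hT], rfl⟩
    have h2 := weightedNorm_add_le Cell.mass_nonneg S T
    simp only [natNorm, mass] at *
    linarith
  | succ r ih =>
    refine le_of_forall_pos_le_add fun ε hε => ?_
    obtain ⟨_, ⟨S, C, hS, rfl⟩, hSε⟩ :=
      Real.lt_sInf_add_pos (natNorm_succ_set_nonempty (r := r) P) (half_pos hε)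
    obtain ⟨_, ⟨T, D, hT, rfl⟩, hTε⟩ :=
      Real.lt_sInf_add_pos (natNorm_succ_set_nonempty (r := r) Q) (half_pos hε)
    have h1 := natNorm_succ_le (fun j => S j + T j) (C + D) (P + Q) (by
      rw [hS, hT]; simp only [map_add, Finset.sum_add_distrib]; abel)
    have h2 : ∑ j, MultiChain.norm (S j + T j) ≤ ∑ j, (S j).norm + ∑ j, (T j).norm := by
      rw [← Finset.sum_add_distrib]
      exact Finset.sum_le_sum fun j _ => weightedNorm_add_le Multicell.norm_nonneg _ _
    have h3 := ih (toPoly C) (toPoly D)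
    rw [map_add] at h1
    simp only [natNorm] at *
    linarith

lemma natNorm_neg_le (r : ℕ) {k : ℕ} (P : PolyChain n k) : natNorm r (-P) ≤ natNorm r P := by
  induction r generalizing k with
  | zero =>
    refine le_csInf (mass_set_nonempty P) ?_
    rintro _ ⟨S, hS, rfl⟩
    exact csInf_le (mass_set_bddBelow _) ⟨-S, by rw [map_neg, hS], by simp⟩
  | succ r ih =>
    refine le_csInf (natNorm_succ_set_nonempty (r := r) P) ?_
    rintro _ ⟨S, C, hS, rfl⟩
    have h1 := natNorm_succ_le (fun j => -S j) (-C) (-P) (by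
      rw [hS]; simp only [map_neg, Finset.sum_neg_distrib]; abel)
    have h2 : ∑ j, MultiChain.norm (-S j) = ∑ j, (S j).norm := by simp [MultiChain.norm]
    have h3 := ih (toPoly C)
    rw [map_neg] at h1
    linarith

lemma natNorm_succ_le_self (r : ℕ) {k : ℕ} (P : PolyChain n k) :
    natNorm (r + 1) P ≤ natNorm r P := by
  induction r generalizing k with
  | zero =>
    refine le_csInf (mass_set_nonempty P) ?_
    rintro _ ⟨S, rfl, rfl⟩
    exact natNorm_succ_le_mass S (natNorm_zero _)
  | succ r ih =>
    refine le_csInf (natNorm_succ_set_nonempty (r := r) P) ?_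
    rintro _ ⟨S, C, hS, rfl⟩
    have h1 := natNorm_succ_le (r := r + 1) (k := k)
      (Fin.snoc (α := fun j : Fin (r + 3) => MultiChain n k j) S 0) C P
      (by rw [hS]; simp [Fin.sum_univ_castSucc (n := r + 2)])
    have h3 := ih (toPoly C)
    simp [Fin.sum_univ_castSucc (n := r + 2)] at h1
    have h4 : MultiChain.norm (0 : MultiChain n k (r + 2)) = 0 := by simp [MultiChain.norm]
    linarith

lemma natNorm_boundary_le (r : ℕ) {k : ℕ} (C : FormalChain n (k + 1)) :
    natNorm (r + 1) (toPoly (boundary C)) ≤ natNorm r (toPoly C) := by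
  have := natNorm_succ_le (r := r) (k := k) (fun _ => 0) C (toPoly (boundary C)) (by simp)
  simpa [MultiChain.norm] using this

end norms

/-! ### Chainlets -/

/-- The group `P_k(ℤ)`, equipped with the `r`-natural norm. -/
def NormedChain (n k _r : ℕ) := PolyChain n k

instance (n k r : ℕ) : AddCommGroup (NormedChain n k r) :=
  inferInstanceAs (AddCommGroup (PolyChain n k))

/-- The `r`-natural norm as a group seminorm. -/
def natSeminorm (n k r : ℕ) : AddGroupSeminorm (NormedChain n k r) where
  toFun P := natNorm (n := n) r (k := k) P
  map_zero' := natNorm_zero r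
  add_le' P Q := natNorm_add_le r P Q
  neg' P := le_antisymm (natNorm_neg_le r P) (by
    have h : natNorm (n := n) r (k := k) (- -P : NormedChain n k r) ≤
        natNorm (n := n) r (k := k) (-P : NormedChain n k r) := natNorm_neg_le r _
    rwa [neg_neg (G := NormedChain n k r)] at h)

instance (n k r : ℕ) : SeminormedAddCommGroup (NormedChain n k r) :=
  (natSeminorm n k r).toSeminormedAddCommGroup

/-- The group `N_k^r(ℤ)` of `k`-dimensional chainlets of class `N^r`: the completion of the group of
polyhedral `k`-chains in the `r`-natural norm. -/
abbrev Chainlet (n k r : ℕ) := UniformSpace.Completion (NormedChain n k r)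

section operators

variable {n k : ℕ}

/-- The class of a formal sum of cells in the group of polyhedral chains with `r`-natural norm. -/
def toNormed (r : ℕ) : FormalChain n k →+ NormedChain n k r := toPoly (n := n) (k := k)

/-- A formal sum of cells as a chainlet of class `N^r`. -/
def toChainlet (r : ℕ) : FormalChain n k →+ Chainlet n k r :=
  (UniformSpace.Completion.toCompl (α := NormedChain n k r)).comp (toNormed r)

lemma norm_toChainlet (r : ℕ) (S : FormalChain n k) :
    ‖toChainlet r S‖ = natNorm r (toPoly S) :=
  UniformSpace.Completion.norm_coe (E := NormedChain n k r) _

/-- The map induced on polyhedral chains by a homomorphism from formal sums of cells to chainlets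
that is bounded by the `r`-natural norm, extended by continuity to the chainlets of class `N^r`. -/
def extendToChainlets {r l s : ℕ} (f : FormalChain n k →+ Chainlet n l s)
    (hf : ∀ S, ‖f S‖ ≤ natNorm r (toPoly S)) : Chainlet n k r →+ Chainlet n l s :=
  let g : NormedChain n k r →+ Chainlet n l s :=
    QuotientAddGroup.lift (nullChains n k) f (fun S hS => by
      have h0 : toPoly S = 0 := (QuotientAddGroup.eq_zero_iff S).2 hS
      have h := hf S
      rw [h0, natNorm_zero] at h
      exact norm_le_zero_iff.1 h)
  (NormedAddGroupHom.extension (g.mkNormedAddGroupHom 1 (fun P => by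
    obtain ⟨S, rfl⟩ := toPoly_surjective (n := n) (k := k) P
    rw [one_mul]
    exact hf S))).toAddMonoidHom

/-- The boundary operator `∂ : N_{k+1}^r → N_k^{r+1}`, the continuous extension of the boundary
operator on polyhedral chains. -/
def chainletBoundary (r : ℕ) : Chainlet n (k + 1) r →+ Chainlet n k (r + 1) :=
  extendToChainlets ((toChainlet (r + 1)).comp boundary) (fun C =>
    (norm_toChainlet (r + 1) (boundary C)).trans_le (natNorm_boundary_le r C))

/-- A chainlet of class `N^r`, considered as a chainlet of class `N^{r+1}`. -/
def chainletInclusion (r : ℕ) : Chainlet n k r →+ Chainlet n k (r + 1) :=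
  extendToChainlets (toChainlet (r + 1)) (fun C =>
    (norm_toChainlet (r + 1) C).trans_le (natNorm_succ_le_self r _))

/-! ### Directional mass cells and the geometric Lie derivative -/

/-- The set swept out by `τ` under translation through `t v`, `0 < t < 1`. -/
def orbit (τ : Cell n k) (v : E n) : Set (E n) :=
  {y | ∃ x ∈ τ.carrier, ∃ t ∈ Set.Ioo (0 : ℝ) 1, y = x + t • v}

open Classical in
/-- The oriented orbit `τ × v`. If `v` is transverse to `τ`, the orbit is a `(k + 1)`-cell, oriented
by `(-v, frame of τ)`, so that `τ` (and not `T_v τ`) inherits its own orientation as part of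
the boundary of `τ × v`. Otherwise the orbit is degenerate (not a `(k + 1)`-cell)
and `τ × v` is the zero chain. -/
def prism (τ : Cell n k) (v : E n) : FormalChain n (k + 1) :=
  if h : ∃ ρ : Cell n (k + 1), ρ.carrier = orbit τ v then
    relSign h.choose.frame (Fin.cons (-v) τ.frame) • single h.choose
  else 0

/-- The sequence `2ʲ (τ × 2⁻ʲ v)`, as chainlets of class `N^1`. -/
def massSeq (v : E n) (τ : Cell n k) (j : ℕ) : Chainlet n (k + 1) 1 :=
  toChainlet 1 ((2 ^ j : ℤ) • prism τ ((2 ^ j : ℝ)⁻¹ • v))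

/-- The directional mass cell `μ_v τ = lim 2ʲ (τ × 2⁻ʲ v)` in the `1`-natural norm. -/
def massCell (v : E n) (τ : Cell n k) : Chainlet n (k + 1) 1 :=
  Filter.limUnder Filter.atTop (massSeq v τ)

/-- `μ_v (∑ aᵢ τᵢ) = ∑ aᵢ μ_v τᵢ`. -/
def massChain (v : E n) : FormalChain n k →+ Chainlet n (k + 1) 1 := linearize (massCell v)

/-- `μ_v ∂σ`, where `∂σ = 0` if `σ` is a `0`-cell. -/
def massBoundary (v : E n) : {k : ℕ} → Cell n k → Chainlet n k 1
  | 0, _ => 0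
  | _ + 1, σ => massChain v (cellBoundary σ)

/-- The sequence `2ʲ (σ - T_{2⁻ʲ v} σ)`, as chainlets of class `N^2`. -/
def lieSeq (v : E n) (σ : Cell n k) (j : ℕ) : Chainlet n k 2 :=
  toChainlet 2 ((2 ^ j : ℤ) • (single σ - single (σ.translate ((2 ^ j : ℝ)⁻¹ • v))))

/-- The geometric Lie derivative `L_v σ = lim 2ʲ (σ - T_{2⁻ʲ v} σ)` in the `2`-natural norm. -/
def lieDerivative (v : E n) (σ : Cell n k) : Chainlet n k 2 :=
  Filter.limUnder Filter.atTop (lieSeq v σ)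

end operators

end Chainlets

end

/-! Everything follows from a homotopy formula that already holds for polyhedral chains: σ - T_v σ =
(∂σ) × v + ∂(σ × v) (`toPoly_sub_translate`; for a point the first term is absent,
`toPoly_sub_translate_of_zero`). Replace v by 2⁻ʲv, multiply by 2ʲ and let j → ∞. The first term on
the right tends to μ_v ∂σ and the second to ∂ μ_v σ, because the inclusion N¹ → N² and ∂ : N¹ → N²
are continuous. So the left side converges too, and its limit is the Lie derivative.

The mass cells exist because a prism of length 2u is cut into two translates of a prism of length u
(`toPoly_prism_two_smul`). Two consecutive terms of the sequence therefore differ by 2ʲ(P - T_u P)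
with P = τ × u and u = 2⁻ʲ⁻¹v. Such a difference is a sum of 2¹-multicells, of norm at most 2ʲ M(P)
‖u‖ ≤ M(τ) ‖v‖² / (4 · 2ʲ), so the sequence is Cauchy (`dist_massSeq_le`).

Since polyhedral chains are identified through integrals of smooth forms, the homotopy formula is
tested on forms. By the fundamental theorem of calculus, the integral of ω over σ - T_v σ is the
integral over 0 < t < 1 of the derivative of ω along -v. The Cartan formula for a constant field
splits this derivative into the contraction of dω with -v and the differential of the contraction of
ω. By Stokes these become the integrals over ∂(σ × v) and (∂σ) × v.

The longest part is Stokes for cells (`formalIntegral_cellBoundary`). It rests on a divergence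
theorem for polyhedra, proved with smooth cutoffs (`integral_fderiv_halfSpaces`), and on matching
the facets, which are defined by closures and chosen arbitrarily, with the half spaces of one fixed
presentation (`IsFacet.exists_halfSpace`). -/

namespace Chainlets

open MeasureTheory Filter Topology

/-! ### Frames and linear changes of variables -/

/-- The linear map that sends the standard basis to a given family of vectors. -/
noncomputable def frameMap {n k : ℕ} (f : Fin k → E n) : E k →L[ℝ] E n :=
  ∑ i, (EuclideanSpace.proj i : E k →L[ℝ] ℝ).smulRight (f i)

lemma frameMap_apply {n k : ℕ} (f : Fin k → E n) (t : E k) : frameMap f t = ∑ i, t i • f i := by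
  simp [frameMap]

@[simp] lemma frameMap_single {n k : ℕ} (f : Fin k → E n) (i : Fin k) :
    frameMap f (EuclideanSpace.single i 1) = f i := by
  simp [frameMap_apply, ite_smul]

lemma Cell.param_eq {n k : ℕ} (σ : Cell n k) (t : E k) :
    σ.param t = σ.base + frameMap σ.frame t := by
  rw [frameMap_apply, Cell.param]

lemma inner_frameMap {n k : ℕ} {f : Fin k → E n} (hf : Orthonormal ℝ f) (s t : E k) :
    ⟪frameMap f s, frameMap f t⟫ = ⟪s, t⟫ := by
  rw [frameMap_apply, frameMap_apply, hf.inner_sum, PiLp.inner_apply]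
  simp [mul_comm]

lemma norm_frameMap {n k : ℕ} {f : Fin k → E n} (hf : Orthonormal ℝ f) (t : E k) :
    ‖frameMap f t‖ = ‖t‖ := by
  rw [@norm_eq_sqrt_real_inner _ _ _ (frameMap f t), inner_frameMap hf,
    ← @norm_eq_sqrt_real_inner]

lemma frameMap_comp {n m k : ℕ} (e : Fin m → E n) (f : Fin k → E m) (t : E k) :
    frameMap e (frameMap f t) = frameMap (fun j => frameMap e (f j)) t := by
  simp [frameMap_apply f, frameMap_apply (fun j => frameMap e (f j)), map_sum]

/-- The matrix of a family of vectors, as columns. -/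
def frameMatrix {n k : ℕ} (f : Fin k → E n) : Matrix (Fin n) (Fin k) ℝ :=
  Matrix.of fun i j => f j i

/-- Alternating maps of top degree on the span of a frame are multiplied by the determinant. -/
lemma map_frameMap_eq_det_mul {n m : ℕ} (φ : E n [⋀^Fin m]→L[ℝ] ℝ) (e : Fin m → E n)
    (f : Fin m → E m) : φ (fun j => frameMap e (f j)) = (frameMatrix f).det * φ e := by
  let ψ : (E m) [⋀^Fin m]→ₗ[ℝ] ℝ :=
    φ.toAlternatingMap.compLinearMap (frameMap e : E m →ₗ[ℝ] E n)
  have h := ψ.eq_smul_basis_det (EuclideanSpace.basisFun (Fin m) ℝ).toBasis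
  have h1 : ψ f = φ (fun j => frameMap e (f j)) := rfl
  have h2 : ψ (EuclideanSpace.basisFun (Fin m) ℝ).toBasis = φ e := by
    change φ (fun j => frameMap e ((EuclideanSpace.basisFun (Fin m) ℝ).toBasis j)) = φ e
    congr 1
    ext1 j
    simp
  have h3 : (EuclideanSpace.basisFun (Fin m) ℝ).toBasis.det f = (frameMatrix f).det := by
    rw [Module.Basis.det_apply]
    rfl
  rw [← h1, h, AlternatingMap.smul_apply, h2, h3, smul_eq_mul, mul_comm]

lemma frameMap_det {m : ℕ} (f : Fin m → E m) : (frameMap f).det = (frameMatrix f).det := by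
  rw [ContinuousLinearMap.det,
    ← LinearMap.det_toMatrix (EuclideanSpace.basisFun (Fin m) ℝ).toBasis]
  congr 1
  ext i j
  rw [LinearMap.toMatrix_apply]
  simp [frameMatrix]

lemma setIntegral_image_affine {m : ℕ} (c : E m) (f : Fin m → E m)
    (hf : (frameMatrix f).det ≠ 0) {S : Set (E m)} (hS : MeasurableSet S) (φ : E m → ℝ) :
    ∫ x in (fun y => c + frameMap f y) '' S, φ x =
      |(frameMatrix f).det| * ∫ y in S, φ (c + frameMap f y) := by
  have hinj : Function.Injective (frameMap f) := by
    rw [← frameMap_det] at hf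
    exact (LinearMap.equivOfDetNeZero (frameMap f : E m →ₗ[ℝ] E m) hf).injective
  rw [integral_image_eq_integral_abs_det_fderiv_smul volume hS
    (f' := fun _ => frameMap f)
    (fun x _ => ((frameMap f).hasFDerivAt.const_add c).hasFDerivWithinAt)
    (fun x _ y _ h => hinj (add_left_cancel h)), frameMap_det, ← integral_const_mul]
  simp

lemma volume_image_affine {m : ℕ} (c : E m) (f : Fin m → E m) (S : Set (E m)) :
    volume ((fun y => c + frameMap f y) '' S) =
      ENNReal.ofReal |(frameMatrix f).det| * volume S := by
  have : (fun y => c + frameMap f y) '' S = (fun y => c + y) '' (frameMap f '' S) := by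
    rw [Set.image_image]
  rw [this, Set.image_add_left, measure_preimage_add, ← frameMap_det]
  exact Measure.addHaar_image_linearMap volume (frameMap f : E m →ₗ[ℝ] E m) S

lemma integral_comp_affine {m : ℕ} (c : E m) (f : Fin m → E m)
    (hf : (frameMatrix f).det ≠ 0) (φ : E m → ℝ) :
    ∫ x, φ x = |(frameMatrix f).det| * ∫ y, φ (c + frameMap f y) := by
  have h := setIntegral_image_affine c f hf MeasurableSet.univ φ
  have hs : (fun y => c + frameMap f y) '' Set.univ = Set.univ := by
    rw [Set.image_univ, Set.range_eq_univ]
    intro x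
    have hf' : LinearMap.det (frameMap f : E m →ₗ[ℝ] E m) ≠ 0 := by
      rw [← frameMap_det] at hf; exact hf
    obtain ⟨y, hy⟩ :=
      (LinearMap.equivOfDetNeZero (frameMap f : E m →ₗ[ℝ] E m) hf').surjective (x - c)
    refine ⟨y, ?_⟩
    have : frameMap f y = x - c := hy
    simp [this]
  rwa [hs, setIntegral_univ, setIntegral_univ] at h

/-- The vector `(t, s₁, …, sₖ)`. -/
noncomputable def consE {k : ℕ} (p : ℝ × E k) : E (k + 1) := WithLp.toLp 2 (Fin.cons p.1 p.2.ofLp)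

@[simp] lemma consE_zero {k : ℕ} (p : ℝ × E k) : consE p 0 = p.1 := rfl

@[simp] lemma consE_succ {k : ℕ} (p : ℝ × E k) (i : Fin k) : consE p i.succ = p.2 i := rfl

/-- `consE` as a measurable equivalence. -/
noncomputable def consEquiv (k : ℕ) : ℝ × E k ≃ᵐ E (k + 1) :=
  ((MeasurableEquiv.prodCongr (MeasurableEquiv.refl ℝ)
      (MeasurableEquiv.toLp 2 (Fin k → ℝ)).symm).trans
    (MeasurableEquiv.piFinSuccAbove (fun _ : Fin (k + 1) => ℝ) 0).symm).trans
      (MeasurableEquiv.toLp 2 (Fin (k + 1) → ℝ))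

lemma consEquiv_apply {k : ℕ} (p : ℝ × E k) : consEquiv k p = consE p := by
  ext i
  refine Fin.cases ?_ (fun i => ?_) i <;> rfl

lemma consEquiv_measurePreserving (k : ℕ) :
    MeasurePreserving (consEquiv k) (volume.prod volume) volume := by
  refine (EuclideanSpace.volume_preserving_symm_measurableEquiv_toLp (Fin (k + 1))).symm.comp
    (((volume_preserving_piFinSuccAbove (fun _ : Fin (k + 1) => ℝ) 0).symm).comp ?_)
  exact (MeasurePreserving.id volume).prod
    (EuclideanSpace.volume_preserving_symm_measurableEquiv_toLp (Fin k))

lemma integral_consE {k : ℕ} (φ : E (k + 1) → ℝ) :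
    ∫ x, φ x = ∫ p : ℝ × E k, φ (consE p) := by
  rw [← (consEquiv_measurePreserving k).integral_comp (consEquiv k).measurableEmbedding]
  simp_rw [consEquiv_apply]
  rfl

lemma frameMap_cons_consE {n k : ℕ} (w : E n) (g : Fin k → E n) (p : ℝ × E k) :
    frameMap (Fin.cons w g : Fin (k + 1) → E n) (consE p) = p.1 • w + frameMap g p.2 := by
  simp [frameMap_apply, Fin.sum_univ_succ]

/-! ### Open polyhedra and cells -/

/-- The intersection of the open half spaces `⟪a, x⟫ < b`, `(a, b) ∈ H`. -/
def halfSpaces {k : ℕ} (H : Finset (E k × ℝ)) : Set (E k) := {x | ∀ h ∈ H, ⟪h.1, x⟫ < h.2}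

lemma isOpen_halfSpaces {k : ℕ} (H : Finset (E k × ℝ)) : IsOpen (halfSpaces H) := by
  have : halfSpaces H = ⋂ h ∈ H, {x | ⟪h.1, x⟫ < h.2} := by ext; simp [halfSpaces]
  rw [this]
  exact isOpen_biInter_finset fun h _ => isOpen_lt (by fun_prop) continuous_const

lemma convex_halfSpaces {k : ℕ} (H : Finset (E k × ℝ)) : Convex ℝ (halfSpaces H) := by
  have : halfSpaces H = ⋂ h ∈ H, {x | innerSL ℝ h.1 x < h.2} := by ext; simp [halfSpaces]
  rw [this]
  exact convex_iInter₂ fun h _ => convex_halfSpace_lt (innerSL ℝ h.1).isLinear _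

/-- An intersection of finitely many open half spaces, where degenerate half spaces (with normal
vector `0`) are allowed. -/
def IsOpenPolyhedron {k : ℕ} (U : Set (E k)) : Prop := ∃ H, U = halfSpaces H

lemma IsOpenPolyhedron.inter {k : ℕ} {U V : Set (E k)} (hU : IsOpenPolyhedron U)
    (hV : IsOpenPolyhedron V) : IsOpenPolyhedron (U ∩ V) := by
  classical
  obtain ⟨H, rfl⟩ := hU
  obtain ⟨K, rfl⟩ := hV
  refine ⟨H ∪ K, ?_⟩
  ext x
  simp only [halfSpaces, Set.mem_inter_iff, Set.mem_ofPred_eq, Finset.mem_union]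
  constructor
  · rintro ⟨h1, h2⟩ h (hh | hh)
    exacts [h1 h hh, h2 h hh]
  · exact fun h => ⟨fun a ha => h a (Or.inl ha), fun a ha => h a (Or.inr ha)⟩

lemma IsOpenPolyhedron.halfSpace {k : ℕ} (L : E k →L[ℝ] ℝ) (b : ℝ) :
    IsOpenPolyhedron {x | L x < b} := by
  refine ⟨{((InnerProductSpace.toDual ℝ (E k)).symm L, b)}, ?_⟩
  ext x
  simp [halfSpaces]

/-- Half spaces pull back along the adjoint of the linear part. The adjoint may kill a normal
vector, which is why degenerate half spaces are admitted. -/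
lemma IsOpenPolyhedron.preimage_affine {k m : ℕ} {U : Set (E k)} (hU : IsOpenPolyhedron U)
    (c : E k) (A : E m →L[ℝ] E k) : IsOpenPolyhedron ((fun x => c + A x) ⁻¹' U) := by
  classical
  obtain ⟨H, rfl⟩ := hU
  refine ⟨H.image fun h => (ContinuousLinearMap.adjoint A h.1, h.2 - ⟪h.1, c⟫), ?_⟩
  ext x
  simp only [halfSpaces, Set.mem_preimage, Set.mem_ofPred_eq, Finset.forall_mem_image,
    ContinuousLinearMap.adjoint_inner_left, inner_add_right]
  exact forall₂_congr fun h _ => by constructor <;> intro <;> linarith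

lemma IsOpenCell.isOpenPolyhedron {k : ℕ} {U : Set (E k)} (hU : IsOpenCell U) :
    IsOpenPolyhedron U := by
  obtain ⟨⟨H, -, h⟩, -⟩ := hU
  exact ⟨H, h⟩

/-- A half space with normal 0 is empty or everything. Nonemptiness excludes the first case, so
these half spaces can be discarded. -/
lemma IsOpenPolyhedron.isOpenCell {k : ℕ} {U : Set (E k)} (hU : IsOpenPolyhedron U)
    (hne : U.Nonempty) (hb : Bornology.IsBounded U) : IsOpenCell U := by
  classical
  obtain ⟨H, rfl⟩ := hU
  refine ⟨⟨H.filter fun h => h.1 ≠ 0, fun h hh => (Finset.mem_filter.1 hh).2, ?_⟩, hne, hb⟩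
  obtain ⟨y, hy⟩ := hne
  ext x
  constructor
  · exact fun hx h hh => hx h (Finset.mem_filter.1 hh).1
  · intro hx h hh
    by_cases h0 : h.1 = 0
    · have := hy h hh
      rw [h0, inner_zero_left] at this ⊢
      exact this
    · exact hx h (Finset.mem_filter.2 ⟨hh, h0⟩)

lemma IsOpenCell.isOpen {k : ℕ} {U : Set (E k)} (hU : IsOpenCell U) : IsOpen U := by
  obtain ⟨H, rfl⟩ := hU.isOpenPolyhedron
  exact isOpen_halfSpaces H

lemma IsOpenCell.convex {k : ℕ} {U : Set (E k)} (hU : IsOpenCell U) : Convex ℝ U := by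
  obtain ⟨H, rfl⟩ := hU.isOpenPolyhedron
  exact convex_halfSpaces H

lemma IsOpenCell.volume_pos {k : ℕ} {U : Set (E k)} (hU : IsOpenCell U) : 0 < volume U :=
  hU.isOpen.measure_pos volume hU.2.1

/-- A cell can be presented by half spaces with unit normals. -/
lemma IsOpenCell.exists_unit_normals {k : ℕ} {U : Set (E k)} (hU : IsOpenCell U) :
    ∃ H : Finset (E k × ℝ), (∀ h ∈ H, ‖h.1‖ = 1) ∧ U = halfSpaces H := by
  classical
  obtain ⟨⟨H, hH, rfl⟩, -⟩ := hU
  refine ⟨H.image fun h => (‖h.1‖⁻¹ • h.1, ‖h.1‖⁻¹ * h.2), ?_, ?_⟩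
  · simp only [Finset.forall_mem_image]
    intro h hh
    exact norm_smul_inv_norm (hH h hh)
  · ext x
    simp only [halfSpaces, Set.mem_ofPred_eq, Finset.forall_mem_image, real_inner_smul_left]
    refine forall₂_congr fun h hh => ?_
    exact (mul_lt_mul_iff_right₀ (inv_pos.2 (norm_pos_iff.2 (hH h hh)))).symm

/-- The projection of `E (k + 1)` to the last `k` coordinates. -/
noncomputable def tailE (k : ℕ) : E (k + 1) →L[ℝ] E k :=
  frameMap (Fin.cons 0 fun i => EuclideanSpace.single i 1)

@[simp] lemma tailE_apply {k : ℕ} (x : E (k + 1)) (i : Fin k) : tailE k x i = x i.succ := by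
  simp [tailE, frameMap_apply, Fin.sum_univ_succ, Pi.single_apply]

@[simp] lemma tailE_consE {k : ℕ} (p : ℝ × E k) : tailE k (consE p) = p.2 := by
  ext i; simp

lemma consE_tailE {k : ℕ} (x : E (k + 1)) : consE (x 0, tailE k x) = x := by
  ext i
  refine Fin.cases ?_ (fun i => ?_) i <;> simp

lemma norm_consE_le {k : ℕ} (p : ℝ × E k) : ‖consE p‖ ≤ |p.1| + ‖p.2‖ := by
  have h : ‖consE p‖ ^ 2 = |p.1| ^ 2 + ‖p.2‖ ^ 2 := by
    rw [EuclideanSpace.norm_sq_eq, Fin.sum_univ_succ, EuclideanSpace.norm_sq_eq]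
    simp
  refine le_of_sq_le_sq ?_ (by positivity)
  nlinarith [abs_nonneg p.1, norm_nonneg p.2]

lemma IsOpenCell.prod_Ioo {k : ℕ} {U : Set (E k)} (hU : IsOpenCell U) :
    IsOpenCell (consE '' (Set.Ioo (0 : ℝ) 1 ×ˢ U)) := by
  have himg : consE '' (Set.Ioo (0 : ℝ) 1 ×ˢ U) =
      ({x | -EuclideanSpace.proj (0 : Fin (k + 1)) x < (0 : ℝ)} ∩
        {x | EuclideanSpace.proj (0 : Fin (k + 1)) x < (1 : ℝ)}) ∩
        (fun x => 0 + tailE k x) ⁻¹' U := by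
    ext x
    constructor
    · rintro ⟨p, ⟨hp1, hp2⟩, rfl⟩
      simp only [Set.mem_inter_iff, Set.mem_ofPred_eq, Set.mem_preimage, zero_add, tailE_consE]
      exact ⟨⟨neg_lt_zero.2 hp1.1, hp1.2⟩, hp2⟩
    · rintro ⟨⟨h1, h2⟩, h3⟩
      refine ⟨(x 0, tailE k x), ⟨⟨neg_lt_zero.1 h1, h2⟩, by simpa using h3⟩, consE_tailE x⟩
  refine IsOpenPolyhedron.isOpenCell ?_ ?_ ?_
  · rw [himg]
    exact ((IsOpenPolyhedron.halfSpace (-EuclideanSpace.proj (0 : Fin (k + 1))) 0).inter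
      (IsOpenPolyhedron.halfSpace (EuclideanSpace.proj (0 : Fin (k + 1))) 1)).inter
      (hU.isOpenPolyhedron.preimage_affine 0 (tailE k))
  · exact (Set.Nonempty.prod ⟨1 / 2, by norm_num⟩ hU.2.1).image _
  · obtain ⟨R, hR⟩ := hU.2.2.exists_norm_le
    refine isBounded_iff_forall_norm_le.2 ⟨1 + R, ?_⟩
    rintro _ ⟨p, ⟨hp1, hp2⟩, rfl⟩
    refine (norm_consE_le p).trans (add_le_add ?_ (hR _ hp2))
    rw [abs_of_pos hp1.1]
    exact hp1.2.le

/-! ### The smooth transition function -/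

/-- The function attains its global minimum 0 at r, so no formula for the derivative is needed. -/
lemma deriv_smoothTransition_of_nonpos {r : ℝ} (hr : r ≤ 0) :
    deriv Real.smoothTransition r = 0 := by
  refine IsLocalMin.deriv_eq_zero (Eventually.of_forall fun x => ?_)
  rw [Real.smoothTransition.zero_of_nonpos hr]
  exact Real.smoothTransition.nonneg x

lemma deriv_smoothTransition_of_one_le {r : ℝ} (hr : 1 ≤ r) :
    deriv Real.smoothTransition r = 0 := by
  refine IsLocalMax.deriv_eq_zero (Eventually.of_forall fun x => ?_)
  rw [Real.smoothTransition.one_of_one_le hr]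
  exact Real.smoothTransition.le_one x

lemma continuous_deriv_smoothTransition : Continuous (deriv Real.smoothTransition) :=
  (Real.smoothTransition.contDiff (n := 1)).continuous_deriv le_rfl

lemma differentiable_smoothTransition : Differentiable ℝ Real.smoothTransition :=
  (Real.smoothTransition.contDiff (n := 1)).differentiable one_ne_zero

lemma exists_abs_deriv_smoothTransition_le :
    ∃ C, 0 ≤ C ∧ ∀ r, |deriv Real.smoothTransition r| ≤ C := by
  obtain ⟨C, hC⟩ := isCompact_Icc.exists_bound_of_continuousOn
    (s := Set.Icc (0 : ℝ) 1) continuous_deriv_smoothTransition.continuousOn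
  refine ⟨C, (norm_nonneg _).trans (hC 0 (by simp)), fun r => ?_⟩
  by_cases h0 : r ≤ 0
  · rw [deriv_smoothTransition_of_nonpos h0, abs_zero]
    exact (norm_nonneg _).trans (hC 0 (by simp))
  by_cases h1 : 1 ≤ r
  · rw [deriv_smoothTransition_of_one_le h1, abs_zero]
    exact (norm_nonneg _).trans (hC 0 (by simp))
  · exact hC r ⟨(not_le.1 h0).le, (not_le.1 h1).le⟩

/-- Rescaled by ε in the direction of a unit normal, this derivative is an approximate delta
function on a hyperplane; total mass one makes the limit the exact facet integral. -/
lemma integral_deriv_smoothTransition : ∫ r, deriv Real.smoothTransition r = 1 := by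
  rw [← setIntegral_eq_integral_of_forall_compl_eq_zero (s := Set.Ioc 0 1),
    ← intervalIntegral.integral_of_le zero_le_one,
    intervalIntegral.integral_deriv_eq_sub (fun x _ => differentiable_smoothTransition x)
      (continuous_deriv_smoothTransition.intervalIntegrable 0 1)]
  · simp
  · intro x hx
    by_cases h0 : x ≤ 0
    · exact deriv_smoothTransition_of_nonpos h0
    · refine deriv_smoothTransition_of_one_le ?_
      by_contra h1
      exact hx ⟨not_le.1 h0, (not_le.1 h1).le⟩

/-- The quotient tends to ±∞ according to the sign of d, and the transition function is constant
outside the unit interval. The shift ε c arises because the evaluation point itself moves with ε. -/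
lemma tendsto_smoothTransition_div {d : ℝ} (hd : d ≠ 0) (c : ℝ) :
    Tendsto (fun ε => Real.smoothTransition ((d + ε * c) / ε)) (𝓝[>] 0)
      (𝓝 (if 0 < d then 1 else 0)) := by
  have hlin : Tendsto (fun ε : ℝ => d + ε * c) (𝓝[>] 0) (𝓝 d) := by
    have : Tendsto (fun ε : ℝ => d + ε * c) (𝓝 0) (𝓝 (d + 0 * c)) :=
      Continuous.tendsto (by fun_prop) 0
    simpa using this.mono_left nhdsWithin_le_nhds
  have hmul : ∀ ε : ℝ, (d + ε * c) / ε = (d + ε * c) * ε⁻¹ := fun ε => div_eq_mul_inv _ _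
  split_ifs with h
  · have h1 : Tendsto (fun ε : ℝ => (d + ε * c) / ε) (𝓝[>] 0) atTop := by
      simp_rw [hmul]
      exact hlin.pos_mul_atTop h tendsto_inv_nhdsGT_zero
    refine tendsto_const_nhds.congr' ?_
    filter_upwards [h1.eventually_ge_atTop 1] with ε hε
    exact (Real.smoothTransition.one_of_one_le hε).symm
  · have h1 : Tendsto (fun ε : ℝ => (d + ε * c) / ε) (𝓝[>] 0) atBot := by
      simp_rw [hmul]
      exact hlin.neg_mul_atTop (lt_of_le_of_ne (not_lt.1 h) hd) tendsto_inv_nhdsGT_zero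
    refine tendsto_const_nhds.congr' ?_
    filter_upwards [h1.eventually_le_atBot 0] with ε hε
    exact (Real.smoothTransition.zero_of_nonpos hε).symm

/-! ### The facets of a polyhedron -/

lemma volume_hyperplane_eq_zero {k : ℕ} {L : E k →L[ℝ] ℝ} (hL : L ≠ 0) (d : ℝ) :
    volume {s | L s = d} = 0 := by
  rcases Set.eq_empty_or_nonempty {s | L s = d} with h | ⟨s₀, hs₀⟩
  · rw [h, measure_empty]
  · have hs₀ : L s₀ = d := hs₀
    have hset : {s | L s = d} =
        (AffineSubspace.mk' s₀ (LinearMap.ker (L : E k →ₗ[ℝ] ℝ)) : Set (E k)) := by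
      ext s
      simp [AffineSubspace.mem_mk', sub_eq_zero, hs₀]
    rw [hset]
    refine Measure.addHaar_affineSubspace _ _ fun htop => hL ?_
    have : LinearMap.ker (L : E k →ₗ[ℝ] ℝ) = ⊤ := by
      rw [← AffineSubspace.direction_mk' s₀ (LinearMap.ker (L : E k →ₗ[ℝ] ℝ)), htop,
        AffineSubspace.direction_top]
    ext s
    have hs : s ∈ LinearMap.ker (L : E k →ₗ[ℝ] ℝ) := this ▸ Submodule.mem_top
    simpa using hs

/-- The Gram matrix of f is diagonal, and its determinant is the square of the determinant of f. -/
lemma det_frameMatrix_sq {m : ℕ} (f : Fin m → E m) (d : Fin m → ℝ)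
    (hf : ∀ i j, ⟪f i, f j⟫ = if i = j then d i else 0) :
    (frameMatrix f).det ^ 2 = ∏ i, d i := by
  have h : (frameMatrix f).transpose * frameMatrix f = Matrix.diagonal d := by
    ext i j
    rw [Matrix.mul_apply, Matrix.diagonal_apply, ← hf, PiLp.inner_apply]
    simp [frameMatrix, mul_comm]
  rw [← Matrix.det_diagonal, ← h, Matrix.det_mul, Matrix.det_transpose, sq]

lemma abs_det_frameMatrix_of_orthonormal {m : ℕ} {f : Fin m → E m} (hf : Orthonormal ℝ f) :
    |(frameMatrix f).det| = 1 := by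
  have h := det_frameMatrix_sq f (fun _ => 1) (orthonormal_iff_ite.1 hf)
  rw [Finset.prod_const_one] at h
  simpa using (sq_eq_sq_iff_abs_eq_abs _ 1).1 (h.trans (one_pow 2).symm)

lemma orthonormal_cons_iff {n k : ℕ} {a : E n} {g : Fin k → E n} :
    Orthonormal ℝ (Fin.cons a g : Fin (k + 1) → E n) ↔
      ‖a‖ = 1 ∧ (∀ i, ⟪a, g i⟫ = 0) ∧ Orthonormal ℝ g := by
  constructor
  · intro h
    refine ⟨by simpa using h.1 0, fun i => by simpa using h.2 (Fin.succ_ne_zero i).symm, ?_⟩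
    exact h.comp Fin.succ (Fin.succ_injective k)
  · rintro ⟨h1, h2, h3⟩
    refine ⟨fun i => ?_, fun i j hij => ?_⟩
    · refine Fin.cases ?_ (fun i => ?_) i
      · simpa using h1
      · simpa using h3.1 i
    · induction i using Fin.cases with
      | zero =>
        induction j using Fin.cases with
        | zero => exact absurd rfl hij
        | succ j => simpa using h2 j
      | succ i =>
        induction j using Fin.cases with
        | zero => simpa [real_inner_comm] using h2 i
        | succ j => simpa using h3.2 (fun h => hij (congrArg _ h))

lemma abs_det_frameMatrix_cons_smul {k : ℕ} {a : E (k + 1)} {g : Fin k → E (k + 1)}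
    (h : Orthonormal ℝ (Fin.cons a g : Fin (k + 1) → E (k + 1))) (c : ℝ) :
    |(frameMatrix (Fin.cons (c • a) g : Fin (k + 1) → E (k + 1))).det| = |c| := by
  obtain ⟨h1, h2, h3⟩ := orthonormal_cons_iff.1 h
  have h := det_frameMatrix_sq (Fin.cons (c • a) g) (Fin.cons (c ^ 2) fun _ => 1) (fun i j => by
    induction i using Fin.cases with
    | zero =>
      induction j using Fin.cases with
      | zero => simp [norm_smul, h1]
      | succ j => simp [real_inner_smul_left, h2, (Fin.succ_ne_zero j).symm]
    | succ i =>
      induction j using Fin.cases with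
      | zero => simp [real_inner_smul_right, real_inner_comm, h2, Fin.succ_ne_zero]
      | succ j => simpa using orthonormal_iff_ite.1 h3 i j)
  rw [Fin.prod_univ_succ] at h
  simp only [Fin.cons_zero, Fin.cons_succ, Finset.prod_const_one, mul_one] at h
  exact (sq_eq_sq_iff_abs_eq_abs _ _).1 h

lemma frameMap_surjective {m : ℕ} {f : Fin m → E m} (hf : Orthonormal ℝ f) :
    Function.Surjective (frameMap f) := by
  have hinj : Function.Injective (frameMap f : E m →ₗ[ℝ] E m) := by
    refine (injective_iff_map_eq_zero _).2 fun x hx => ?_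
    have : ‖frameMap f x‖ = 0 := by rw [norm_eq_zero]; exact hx
    rwa [norm_frameMap hf, norm_eq_zero] at this
  exact LinearMap.injective_iff_surjective.1 hinj

/-- The hyperplane of a half space meets the hyperplanes of other half spaces in null sets. -/
lemma volume_inter_hyperplane_eq_zero {k : ℕ} {h h' : E (k + 1) × ℝ} {g : Fin k → E (k + 1)}
    {y x : E (k + 1)} (hg : Orthonormal ℝ (Fin.cons h.1 g : Fin (k + 1) → E (k + 1)))
    (hy : ⟪h.1, y⟫ = h.2) (hh' : ‖h'.1‖ = 1) (hne : h' ≠ h) (hx : ⟪h.1, x⟫ < h.2)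
    (hx' : ⟪h'.1, x⟫ < h'.2) : volume {s | ⟪h'.1, y + frameMap g s⟫ = h'.2} = 0 := by
  -- Either `h'.1` is not constant along the hyperplane of `h`, and a proper affine hyperplane is
  -- null; or the two unit normals are parallel, and the set turns out to be empty.
  by_cases hL : (innerSL ℝ h'.1).comp (frameMap g) = 0
  · obtain ⟨t, ht⟩ := frameMap_surjective hg h'.1
    obtain ⟨h1, h2, h3⟩ := orthonormal_cons_iff.1 hg
    rw [← consE_tailE t, frameMap_cons_consE] at ht
    have htail : tailE k t = 0 := by
      have h4 : ⟪h'.1, frameMap g (tailE k t)⟫ = 0 := congrArg (fun L => L (tailE k t)) hL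
      have h5 : ⟪h.1, frameMap g (tailE k t)⟫ = 0 := by
        simp [frameMap_apply, inner_sum, real_inner_smul_right, h2]
      rw [← ht, inner_add_left, real_inner_smul_left, h5, mul_zero, zero_add, inner_frameMap h3,
        inner_self_eq_zero] at h4
      exact h4
    rw [htail, map_zero, add_zero] at ht
    have habs : |t 0| = 1 := by
      rw [← ht, norm_smul, h1, mul_one] at hh'
      exact hh'
    have hempty : {s | ⟪h'.1, y + frameMap g s⟫ = h'.2} = ∅ := by
      refine Set.eq_empty_of_forall_notMem fun s hs => ?_
      have hs : ⟪h'.1, y + frameMap g s⟫ = h'.2 := hs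
      have h4 : ⟪h'.1, frameMap g s⟫ = 0 := congrArg (fun L => L s) hL
      rw [inner_add_right, h4, add_zero, ← ht, real_inner_smul_left, hy] at hs
      rw [← ht, real_inner_smul_left] at hx'
      change t 0 * h.2 = h'.2 at hs
      change t 0 * ⟪h.1, x⟫ < h'.2 at hx'
      change t 0 • h.1 = h'.1 at ht
      -- A common boundary point and equal normals force `h' = h`. Opposite normals give
      -- complementary open half spaces, which cannot both contain `x`.
      rcases eq_or_eq_neg_of_abs_eq habs with h0 | h0
      · rw [h0] at hs ht
        exact hne (Prod.ext (by rw [← ht, one_smul]) (by rw [← hs, one_mul]))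
      · rw [h0] at hs hx'
        linarith
    rw [hempty, measure_empty]
  · have := volume_hyperplane_eq_zero hL (h'.2 - ⟪h'.1, y⟫)
    convert this using 3 with s
    simp only [inner_add_right, ContinuousLinearMap.comp_apply, innerSL_apply_apply]
    funext s
    exact propext (by constructor <;> intro <;> linarith)

/-! ### The divergence theorem for polyhedra -/

/-- A smooth approximation of the indicator function of the half space `h`. -/
noncomputable def bump {m : ℕ} (ε : ℝ) (h : E m × ℝ) (x : E m) : ℝ :=
  Real.smoothTransition ((h.2 - ⟪h.1, x⟫) / ε)

lemma bump_nonneg {m : ℕ} (ε : ℝ) (h : E m × ℝ) (x : E m) : 0 ≤ bump ε h x :=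
  Real.smoothTransition.nonneg _

lemma bump_le_one {m : ℕ} (ε : ℝ) (h : E m × ℝ) (x : E m) : bump ε h x ≤ 1 :=
  Real.smoothTransition.le_one _

lemma continuous_bump {m : ℕ} (ε : ℝ) (h : E m × ℝ) : Continuous (bump ε h) :=
  Real.smoothTransition.continuous.comp (by fun_prop)

lemma lt_of_bump_ne_zero {m : ℕ} {ε : ℝ} (hε : 0 < ε) {h : E m × ℝ} {x : E m}
    (hx : bump ε h x ≠ 0) : ⟪h.1, x⟫ < h.2 := by
  by_contra hlt
  exact hx (Real.smoothTransition.zero_of_nonpos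
    (div_nonpos_of_nonpos_of_nonneg (by linarith) hε.le))

lemma hasFDerivAt_bump {m : ℕ} (ε : ℝ) (h : E m × ℝ) (x : E m) :
    HasFDerivAt (bump ε h)
      ((-(ε⁻¹ * deriv Real.smoothTransition ((h.2 - ⟪h.1, x⟫) / ε))) • innerSL ℝ h.1) x := by
  have h1 : HasFDerivAt (fun x => (h.2 - ⟪h.1, x⟫) / ε) ((-ε⁻¹) • innerSL ℝ h.1) x := by
    have := ((innerSL ℝ h.1).hasFDerivAt (x := x)).const_sub h.2 |>.mul_const ε⁻¹
    simpa [div_eq_mul_inv] using this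
  have h2 := (differentiable_smoothTransition ((h.2 - ⟪h.1, x⟫) / ε)).hasDerivAt.comp_hasFDerivAt
    x h1
  refine h2.congr_fderiv ?_
  rw [smul_smul]
  congr 1
  ring

lemma abs_prod_bump_le_one {m : ℕ} (ε : ℝ) (K : Finset (E m × ℝ)) (x : E m) :
    |∏ h ∈ K, bump ε h x| ≤ 1 := by
  rw [abs_of_nonneg (Finset.prod_nonneg fun h _ => bump_nonneg ε h x)]
  exact Finset.prod_le_one (fun h _ => bump_nonneg ε h x) fun h _ => bump_le_one ε h x

/-- The part of the hyperplane through `y` spanned by `g` that lies in all the half spaces of `H`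
other than `h`. -/
def facetRegion {k m : ℕ} (H : Finset (E m × ℝ)) (h : E m × ℝ) (y : E m) (g : Fin k → E m) :
    Set (E k) :=
  {s | ∀ h' ∈ H, h' ≠ h → ⟪h'.1, y + frameMap g s⟫ < h'.2}

lemma measurableSet_facetRegion {k m : ℕ} (H : Finset (E m × ℝ)) (h : E m × ℝ) (y : E m)
    (g : Fin k → E m) : MeasurableSet (facetRegion H h y g) := by
  classical
  have : facetRegion H h y g =
      ⋂ h' ∈ H.filter (· ≠ h), {s | ⟪h'.1, y + frameMap g s⟫ < h'.2} := by
    ext; simp [facetRegion]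
  rw [this]
  exact (isOpen_biInter_finset fun h' _ =>
    isOpen_lt (by fun_prop) continuous_const).measurableSet

lemma integrable_of_continuous_of_eq_zero {m : ℕ} {f : E m → ℝ} (hf : Continuous f)
    {U : Set (E m)} (hU : Bornology.IsBounded U) (h0 : ∀ x, f x ≠ 0 → x ∈ U) :
    Integrable f := by
  refine hf.integrable_of_hasCompactSupport ?_
  obtain ⟨R, hR⟩ := hU.subset_closedBall 0
  exact HasCompactSupport.intro (isCompact_closedBall 0 R)
    fun x hx => by_contra fun hne => hx (hR (h0 x hne))

-- The weight in front lives in a layer of thickness ε inside the hyperplane of `h`. Stretching this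
-- layer by 1/ε in the normal direction removes ε from the weight, and in the limit the layer
-- collapses to the hyperplane while the remaining cutoffs become the indicator function of the
-- facet.
open Classical in
lemma tendsto_integral_bump_facet {k : ℕ} {H : Finset (E (k + 1) × ℝ)}
    (hunit : ∀ h ∈ H, ‖h.1‖ = 1) (hne : (halfSpaces H).Nonempty)
    (hb : Bornology.IsBounded (halfSpaces H)) {f : E (k + 1) → ℝ} (hf : Continuous f)
    {h : E (k + 1) × ℝ} (hh : h ∈ H) {y : E (k + 1)} {g : Fin k → E (k + 1)}
    (hy : ⟪h.1, y⟫ = h.2) (hg : Orthonormal ℝ (Fin.cons h.1 g : Fin (k + 1) → E (k + 1))) :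
    Tendsto (fun ε : ℝ => ∫ x, (ε⁻¹ * deriv Real.smoothTransition ((h.2 - ⟪h.1, x⟫) / ε)) *
        (∏ h' ∈ H.erase h, bump ε h' x) * f x) (𝓝[>] 0)
      (𝓝 (∫ s in facetRegion H h y g, f (y + frameMap g s))) := by
  obtain ⟨ha, hag, hg'⟩ := orthonormal_cons_iff.1 hg
  obtain ⟨C, hC0, hC⟩ := exists_abs_deriv_smoothTransition_le
  obtain ⟨R, hR⟩ := hb.exists_norm_le
  obtain ⟨K, hK⟩ := (isCompact_closedBall (0 : E (k + 1)) R).exists_bound_of_continuousOn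
    hf.continuousOn
  -- Stretched coordinates: `p.1` is the depth below the hyperplane in units of ε, `p.2` the
  -- position along it. The Jacobian ε cancels the factor `ε⁻¹`.
  set X : ℝ → ℝ × E k → E (k + 1) := fun ε p => y + (p.1 • ((-ε) • h.1) + frameMap g p.2)
    with hX
  have hXh : ∀ ε p, h.2 - ⟪h.1, X ε p⟫ = ε * p.1 := by
    intro ε p
    have h5 : ⟪h.1, frameMap g p.2⟫ = 0 := by
      simp [frameMap_apply, inner_sum, real_inner_smul_right, hag]
    simp only [hX, inner_add_right, real_inner_smul_right, h5, hy, real_inner_self_eq_norm_sq, ha]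
    ring
  have hXc : ∀ ε, Continuous (X ε) := fun ε => by fun_prop
  set G : ℝ → ℝ × E k → ℝ := fun ε p => deriv Real.smoothTransition p.1 *
    (∏ h' ∈ H.erase h, bump ε h' (X ε p)) * f (X ε p) with hG
  -- change of variables
  have hcov : ∀ ε : ℝ, 0 < ε → ∫ x, (ε⁻¹ * deriv Real.smoothTransition ((h.2 - ⟪h.1, x⟫) / ε)) *
        (∏ h' ∈ H.erase h, bump ε h' x) * f x = ∫ p, G ε p := by
    intro ε hε
    have hdet := abs_det_frameMatrix_cons_smul hg (-ε)
    rw [abs_neg, abs_of_pos hε] at hdet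
    rw [integral_comp_affine y (Fin.cons ((-ε) • h.1) g)
      (fun h0 => by rw [h0, abs_zero] at hdet; exact hε.ne hdet), hdet,
      integral_consE, ← integral_const_mul]
    refine integral_congr_ae (Eventually.of_forall fun p => ?_)
    simp only [frameMap_cons_consE]
    change ε * (ε⁻¹ * deriv Real.smoothTransition ((h.2 - ⟪h.1, X ε p⟫) / ε) *
        (∏ h' ∈ H.erase h, bump ε h' (X ε p)) * f (X ε p)) = _
    rw [hXh, mul_div_cancel_left₀ _ hε.ne']
    simp only [hG]
    field_simp
  have hlim : ∫ s in facetRegion H h y g, f (y + frameMap g s) =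
      ∫ p : ℝ × E k, deriv Real.smoothTransition p.1 *
        (facetRegion H h y g).indicator (fun s => f (y + frameMap g s)) p.2 := by
    rw [← integral_indicator (measurableSet_facetRegion H h y g)]
    have := integral_prod_mul (μ := (volume : Measure ℝ)) (ν := (volume : Measure (E k)))
      (deriv Real.smoothTransition)
      ((facetRegion H h y g).indicator (fun s => f (y + frameMap g s)))
    rw [integral_deriv_smoothTransition, one_mul] at this
    exact this.symm
  rw [hlim]
  refine Tendsto.congr' (f₁ := fun ε => ∫ p, G ε p) ?_ ?_
  · filter_upwards [self_mem_nhdsWithin] with ε hε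
    exact (hcov ε hε).symm
  -- Where the integrand is nonzero, the depth lies in (0, 1) and `X ε p` in the polyhedron, hence
  -- in the ball of radius `R`. For ε < 1 this bounds `p.2` by `R + ‖y‖ + 1`.
  refine tendsto_integral_filter_of_dominated_convergence
    ((Set.Icc (0 : ℝ) 1 ×ˢ Metric.closedBall (0 : E k) (R + ‖y‖ + 1)).indicator
      fun _ => C * |K|) ?_ ?_ ?_ ?_
  · refine Eventually.of_forall fun ε => Continuous.aestronglyMeasurable ?_
    refine ((continuous_deriv_smoothTransition.comp continuous_fst).mul
      (continuous_finsetProd _ fun h' _ => (continuous_bump ε h').comp (hXc ε))).mul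
      (hf.comp (hXc ε))
  · filter_upwards [Ioo_mem_nhdsGT (zero_lt_one' ℝ)] with ε hε
    refine Eventually.of_forall fun p => ?_
    by_cases hGp : G ε p = 0
    · rw [hGp, norm_zero]
      exact Set.indicator_nonneg (fun _ _ => by positivity) _
    have h1 : deriv Real.smoothTransition p.1 ≠ 0 := fun h0 => hGp (by simp [hG, h0])
    have h2 : ∀ h' ∈ H.erase h, bump ε h' (X ε p) ≠ 0 := fun h' hh' h0 =>
      hGp (by simp only [hG]; rw [Finset.prod_eq_zero hh' h0]; ring)
    have hp0 : 0 < p.1 := not_le.1 fun h0 => h1 (deriv_smoothTransition_of_nonpos h0)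
    have hp1 : p.1 < 1 := not_le.1 fun h0 => h1 (deriv_smoothTransition_of_one_le h0)
    have hXU : X ε p ∈ halfSpaces H := by
      intro h' hh'
      by_cases heq : h' = h
      · have := hXh ε p
        rw [heq]
        nlinarith [mul_pos hε.1 hp0]
      · exact lt_of_bump_ne_zero hε.1 (h2 h' (Finset.mem_erase.2 ⟨heq, hh'⟩))
    have hXR := hR _ hXU
    have hp2 : ‖p.2‖ ≤ R + ‖y‖ + 1 := by
      have hdec : frameMap g p.2 = X ε p - y + (p.1 * ε) • h.1 := by
        simp only [hX]
        module
      rw [← norm_frameMap hg', hdec]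
      refine (norm_add_le _ _).trans (add_le_add ((norm_sub_le _ _).trans (by gcongr)) ?_)
      rw [norm_smul, ha, mul_one, Real.norm_of_nonneg (mul_pos hp0 hε.1).le]
      nlinarith [hε.1, hε.2]
    rw [Set.indicator_of_mem (show p ∈ Set.Icc (0 : ℝ) 1 ×ˢ Metric.closedBall (0 : E k)
      (R + ‖y‖ + 1) from ⟨⟨hp0.le, hp1.le⟩, by simpa using hp2⟩)]
    have h3 := abs_prod_bump_le_one ε (H.erase h) (X ε p)
    have h4 : |f (X ε p)| ≤ |K| := (hK _ (by simpa using hXR)).trans (le_abs_self K)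
    simp only [hG, Real.norm_eq_abs, abs_mul]
    calc _ ≤ C * 1 * |K| := by gcongr; exact hC _
      _ = _ := by ring
  · refine (integrable_indicator_iff (measurableSet_Icc.prod measurableSet_closedBall)).2 ?_
    refine integrableOn_const ?_
    rw [Measure.volume_eq_prod, Measure.prod_prod]
    exact ENNReal.mul_ne_top (by simp) (measure_closedBall_lt_top).ne
  · obtain ⟨x₀, hx₀⟩ := hne
    -- The limit of a cutoff is undetermined only on its own hyperplane, which meets the hyperplane
    -- of `h` in a null set.
    have hnull : ∀ᵐ s : E k, ∀ h' ∈ H.erase h, ⟪h'.1, y + frameMap g s⟫ ≠ h'.2 := by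
      refine (ae_ball_iff (Finset.countable_toSet _)).2 fun h' hh' => ?_
      have hh'' := Finset.mem_erase.1 hh'
      rw [ae_iff]
      simpa using volume_inter_hyperplane_eq_zero hg hy (hunit h' hh''.2) hh''.1 (hx₀ h hh)
        (hx₀ h' hh''.2)
    have hnull' : ∀ᵐ p : ℝ × E k, ∀ h' ∈ H.erase h, ⟪h'.1, y + frameMap g p.2⟫ ≠ h'.2 :=
      (Measure.quasiMeasurePreserving_snd (μ := (volume : Measure ℝ))
        (ν := (volume : Measure (E k)))).ae hnull
    filter_upwards [hnull'] with p hp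
    have hXt : Tendsto (fun ε => X ε p) (𝓝[>] 0) (𝓝 (y + frameMap g p.2)) := by
      have : Tendsto (fun ε => X ε p) (𝓝 0) (𝓝 (X 0 p)) :=
        Continuous.tendsto (by simp only [hX]; fun_prop) 0
      have h0 : X 0 p = y + frameMap g p.2 := by simp [hX]
      rw [h0] at this
      exact this.mono_left nhdsWithin_le_nhds
    have hprod : Tendsto (fun ε => ∏ h' ∈ H.erase h, bump ε h' (X ε p)) (𝓝[>] 0)
        (𝓝 (∏ h' ∈ H.erase h, if 0 < h'.2 - ⟪h'.1, y + frameMap g p.2⟫ then 1 else 0)) := by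
      refine tendsto_finsetProd _ fun h' hh' => ?_
      have := tendsto_smoothTransition_div (sub_ne_zero.2 (hp h' hh').symm) (p.1 * ⟪h'.1, h.1⟫)
      refine this.congr fun ε => ?_
      simp only [bump, hX, inner_add_right, real_inner_smul_right]
      congr 2
      ring
    have hfin := (hprod.const_mul (deriv Real.smoothTransition p.1)).mul
      ((hf.tendsto _).comp hXt)
    have hval : deriv Real.smoothTransition p.1 *
        (facetRegion H h y g).indicator (fun s => f (y + frameMap g s)) p.2 =
        deriv Real.smoothTransition p.1 *
          (∏ h' ∈ H.erase h, if 0 < h'.2 - ⟪h'.1, y + frameMap g p.2⟫ then 1 else 0) *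
          f (y + frameMap g p.2) := by
      rw [Finset.prod_ite_zero, Finset.prod_const_one]
      by_cases hmem : p.2 ∈ facetRegion H h y g
      · rw [Set.indicator_of_mem hmem, if_pos, mul_one]
        intro h' hh'
        exact sub_pos.2 (hmem h' (Finset.mem_erase.1 hh').2 (Finset.mem_erase.1 hh').1)
      · rw [Set.indicator_of_notMem hmem, if_neg, mul_zero, zero_mul]
        exact fun hall => hmem fun h' hh' hne' =>
          sub_pos.1 (hall h' (Finset.mem_erase.2 ⟨hne', hh'⟩))
    rw [hval]
    exact hfin

/-- The divergence theorem for a bounded polyhedron, for a vector field of constant direction. -/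
theorem integral_fderiv_halfSpaces {k : ℕ} {H : Finset (E (k + 1) × ℝ)}
    (hunit : ∀ h ∈ H, ‖h.1‖ = 1) (hne : (halfSpaces H).Nonempty)
    (hb : Bornology.IsBounded (halfSpaces H)) {f : E (k + 1) → ℝ} (hf : ContDiff ℝ 1 f)
    (w : E (k + 1)) (y : E (k + 1) × ℝ → E (k + 1)) (g : E (k + 1) × ℝ → Fin k → E (k + 1))
    (hy : ∀ h ∈ H, ⟪h.1, y h⟫ = h.2)
    (hg : ∀ h ∈ H, Orthonormal ℝ (Fin.cons h.1 (g h) : Fin (k + 1) → E (k + 1))) :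
    ∫ x in halfSpaces H, fderiv ℝ f x w =
      ∑ h ∈ H, ⟪h.1, w⟫ * ∫ s in facetRegion H h (y h) (g h), f (y h + frameMap (g h) s) := by
  classical
  have hf' : Continuous fun x => fderiv ℝ f x w :=
    (hf.continuous_fderiv one_ne_zero).clm_apply continuous_const
  have hprod_ne : ∀ ε : ℝ, 0 < ε → ∀ x, ∏ h ∈ H, bump ε h x ≠ 0 → x ∈ halfSpaces H :=
    fun ε hε x hx h hh => lt_of_bump_ne_zero hε (Finset.prod_ne_zero_iff.1 hx h hh)
  -- The part of the derivative of the product of cutoffs that comes from the factor `h` is `-D ε h`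
  -- times the covector of `h.1`.
  set D : ℝ → E (k + 1) × ℝ → E (k + 1) → ℝ := fun ε h x =>
    (ε⁻¹ * deriv Real.smoothTransition ((h.2 - ⟪h.1, x⟫) / ε)) * ∏ h' ∈ H.erase h, bump ε h' x
    with hD
  have hDc : ∀ ε h, Continuous (D ε h) := fun ε h =>
    (continuous_const.mul (continuous_deriv_smoothTransition.comp (by fun_prop))).mul
      (continuous_finsetProd _ fun h' _ => continuous_bump ε h')
  have hD_ne : ∀ ε : ℝ, 0 < ε → ∀ h ∈ H, ∀ x, D ε h x ≠ 0 → x ∈ halfSpaces H := by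
    intro ε hε h hh x hx h' hh'
    by_cases heq : h' = h
    · by_contra hlt
      refine hx ?_
      simp only [hD]
      rw [deriv_smoothTransition_of_nonpos, mul_zero, zero_mul]
      rw [heq] at hlt
      exact div_nonpos_of_nonpos_of_nonneg (by linarith) hε.le
    · exact lt_of_bump_ne_zero hε (Finset.prod_ne_zero_iff.1 (right_ne_zero_of_mul hx) h'
        (Finset.mem_erase.2 ⟨heq, hh'⟩))
  have hfd : ∀ ε x, HasFDerivAt (fun x => ∏ h ∈ H, bump ε h x)
      (∑ h ∈ H, (-D ε h x) • innerSL ℝ h.1) x := by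
    intro ε x
    have := HasFDerivAt.finsetProd (u := H) fun h _ => hasFDerivAt_bump ε h x
    refine this.congr_fderiv ?_
    refine Finset.sum_congr rfl fun h _ => ?_
    rw [smul_smul]
    congr 1
    simp only [hD]
    ring
  have hfdw : ∀ ε x, fderiv ℝ (fun x => ∏ h ∈ H, bump ε h x) x w =
      ∑ h ∈ H, -(⟪h.1, w⟫ * D ε h x) := by
    intro ε x
    rw [(hfd ε x).fderiv]
    simp [mul_comm]
  -- Integration by parts on the whole space. There are no boundary terms, since the cutoff vanishes
  -- outside the bounded polyhedron; letting ε → 0 on both sides gives the theorem.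
  have hparts : ∀ ε : ℝ, 0 < ε → ∫ x, (∏ h ∈ H, bump ε h x) * fderiv ℝ f x w =
      ∑ h ∈ H, ⟪h.1, w⟫ * ∫ x, D ε h x * f x := by
    intro ε hε
    have hχ : Continuous fun x => ∏ h ∈ H, bump ε h x :=
      continuous_finsetProd _ fun h' _ => continuous_bump ε h'
    have hint : ∀ h ∈ H, Integrable fun x => D ε h x * f x := fun h hh =>
      integrable_of_continuous_of_eq_zero ((hDc ε h).mul hf.continuous) hb
        fun x hx => hD_ne ε hε h hh x (left_ne_zero_of_mul hx)
    have hsum : (fun x => fderiv ℝ (fun x => ∏ h ∈ H, bump ε h x) x w * f x) =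
        fun x => ∑ h ∈ H, -(⟪h.1, w⟫ * (D ε h x * f x)) := by
      ext x
      rw [hfdw, Finset.sum_mul]
      exact Finset.sum_congr rfl fun h _ => by ring
    rw [integral_mul_fderiv_eq_neg_fderiv_mul_of_integrable, hsum, integral_finsetSum]
    · simp only [integral_neg, integral_const_mul, Finset.sum_neg_distrib, neg_neg]
    · exact fun h hh => ((hint h hh).const_mul _).neg
    · rw [hsum]
      exact integrable_finsetSum _ fun h hh => ((hint h hh).const_mul _).neg
    · exact integrable_of_continuous_of_eq_zero (hχ.mul hf') hb
        fun x hx => hprod_ne ε hε x (left_ne_zero_of_mul hx)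
    · exact integrable_of_continuous_of_eq_zero (hχ.mul hf.continuous) hb
        fun x hx => hprod_ne ε hε x (left_ne_zero_of_mul hx)
    · exact fun x _ => (hfd ε x).differentiableAt
    · exact fun x _ => hf.differentiable one_ne_zero x
  have hR : Tendsto (fun ε => ∑ h ∈ H, ⟪h.1, w⟫ * ∫ x, D ε h x * f x) (𝓝[>] 0)
      (𝓝 (∑ h ∈ H, ⟪h.1, w⟫ *
        ∫ s in facetRegion H h (y h) (g h), f (y h + frameMap (g h) s))) :=
    tendsto_finsetSum _ fun h hh => (tendsto_integral_bump_facet hunit hne hb hf.continuous hh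
      (hy h hh) (hg h hh)).const_mul _
  have hL : Tendsto (fun ε => ∫ x, (∏ h ∈ H, bump ε h x) * fderiv ℝ f x w) (𝓝[>] 0)
      (𝓝 (∫ x in halfSpaces H, fderiv ℝ f x w)) := by
    rw [← integral_indicator (isOpen_halfSpaces H).measurableSet]
    refine tendsto_integral_filter_of_dominated_convergence
      ((halfSpaces H).indicator fun x => |fderiv ℝ f x w|) ?_ ?_ ?_ ?_
    · exact Eventually.of_forall fun ε => ((continuous_finsetProd _
        fun h' _ => continuous_bump ε h').mul hf').aestronglyMeasurable
    · filter_upwards [self_mem_nhdsWithin] with ε hε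
      refine Eventually.of_forall fun x => ?_
      by_cases hx : x ∈ halfSpaces H
      · rw [Set.indicator_of_mem hx, Real.norm_eq_abs, abs_mul]
        exact mul_le_of_le_one_left (abs_nonneg _) (abs_prod_bump_le_one ε H x)
      · rw [Set.indicator_of_notMem hx, not_not.1 (mt (hprod_ne ε hε x) hx), zero_mul, norm_zero]
    · refine (integrable_indicator_iff (isOpen_halfSpaces H).measurableSet).2 ?_
      obtain ⟨R, hR⟩ := hb.subset_closedBall 0
      exact (hf'.abs.continuousOn.integrableOn_compact (isCompact_closedBall 0 R)).mono_set hR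
    · refine Eventually.of_forall fun x => ?_
      by_cases hx : x ∈ halfSpaces H
      · rw [Set.indicator_of_mem hx]
        have : Tendsto (fun ε => ∏ h ∈ H, bump ε h x) (𝓝[>] 0) (𝓝 (∏ h ∈ H, 1)) := by
          refine tendsto_finsetProd _ fun h hh => ?_
          have h1 := tendsto_smoothTransition_div (sub_pos.2 (hx h hh)).ne' 0
          rw [if_pos (sub_pos.2 (hx h hh))] at h1
          simpa [bump] using h1
        rw [Finset.prod_const_one] at this
        simpa using this.mul_const (fderiv ℝ f x w)
      · rw [Set.indicator_of_notMem hx]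
        refine tendsto_const_nhds.congr' ?_
        filter_upwards [self_mem_nhdsWithin] with ε hε
        rw [not_not.1 (mt (hprod_ne ε hε x) hx), zero_mul]
  refine tendsto_nhds_unique hL (hR.congr' ?_)
  filter_upwards [self_mem_nhdsWithin] with ε hε
  exact (hparts ε hε).symm

/-! ### The facets of a cell -/

lemma closure_forall_lt {m : ℕ} {ι : Type*} (K : Finset ι) (L : ι → E m →L[ℝ] ℝ) (b : ι → ℝ)
    (hne : {x | ∀ i ∈ K, L i x < b i}.Nonempty) :
    closure {x | ∀ i ∈ K, L i x < b i} = {x | ∀ i ∈ K, L i x ≤ b i} := by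
  refine subset_antisymm (closure_minimal (fun x hx i hi => (hx i hi).le) ?_) fun x hx => ?_
  · have : {x | ∀ i ∈ K, L i x ≤ b i} = ⋂ i ∈ K, {x | L i x ≤ b i} := by ext; simp
    rw [this]
    exact isClosed_biInter fun i _ => isClosed_le (L i).continuous continuous_const
  · obtain ⟨z, hz⟩ := hne
    have hlim : Tendsto (fun t : ℝ => x + t • (z - x)) (𝓝[>] 0) (𝓝 x) := by
      have : Tendsto (fun t : ℝ => x + t • (z - x)) (𝓝 0) (𝓝 (x + (0 : ℝ) • (z - x))) :=
        Continuous.tendsto (by fun_prop) 0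
      rw [zero_smul, add_zero] at this
      exact this.mono_left nhdsWithin_le_nhds
    refine mem_closure_of_tendsto hlim ?_
    filter_upwards [Ioo_mem_nhdsGT (zero_lt_one' ℝ)] with t ht i hi
    have h1 : L i x ≤ b i := hx i hi
    have h2 : L i z < b i := hz i hi
    simp only [map_add, map_smul, map_sub, smul_eq_mul]
    nlinarith [ht.1, ht.2]

lemma closure_halfSpaces {m : ℕ} {H : Finset (E m × ℝ)} (hne : (halfSpaces H).Nonempty) :
    closure (halfSpaces H) = {x | ∀ h ∈ H, ⟪h.1, x⟫ ≤ h.2} :=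
  closure_forall_lt H (fun h => innerSL ℝ h.1) (fun h => h.2) hne

/-! ### Closures of facet regions -/

section facetRegion

variable {k m : ℕ} {H : Finset (E m × ℝ)} {h : E m × ℝ} {y : E m} {g : Fin k → E m}

lemma isOpenPolyhedron_facetRegion : IsOpenPolyhedron (facetRegion H h y g) := by
  classical
  have : facetRegion H h y g =
      (fun s => y + frameMap g s) ⁻¹' halfSpaces (H.filter (· ≠ h)) := by
    ext; simp [facetRegion, halfSpaces]
  rw [this]
  exact IsOpenPolyhedron.preimage_affine ⟨_, rfl⟩ y (frameMap g)

lemma closure_facetRegion (hne : (facetRegion H h y g).Nonempty) :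
    closure (facetRegion H h y g) = {s | ∀ h' ∈ H, h' ≠ h → ⟪h'.1, y + frameMap g s⟫ ≤ h'.2} := by
  classical
  have h1 : facetRegion H h y g = {s | ∀ h' ∈ H.filter (· ≠ h),
      ((innerSL ℝ h'.1).comp (frameMap g)) s < h'.2 - ⟪h'.1, y⟫} := by
    ext s
    simp [facetRegion, inner_add_right, lt_sub_iff_add_lt']
  rw [h1] at hne ⊢
  rw [closure_forall_lt _ _ _ hne]
  ext s
  simp [inner_add_right, le_sub_iff_add_le']

lemma inner_add_frameMap (hy : ⟪h.1, y⟫ = h.2) (hg : ∀ i, ⟪h.1, g i⟫ = 0) (s : E k) :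
    ⟪h.1, y + frameMap g s⟫ = h.2 := by
  simp [inner_add_right, hy, frameMap_apply, inner_sum, real_inner_smul_right, hg]

/-- On the hyperplane of `h` the weak inequality of `h` itself is automatic, so it may be added to
the other weak inequalities. -/
lemma closure_facetRegion_eq (hne : (facetRegion H h y g).Nonempty)
    (hU : (halfSpaces H).Nonempty) (hy : ⟪h.1, y⟫ = h.2) (hg : ∀ i, ⟪h.1, g i⟫ = 0) :
    closure (facetRegion H h y g) = {s | y + frameMap g s ∈ closure (halfSpaces H)} := by
  rw [closure_facetRegion hne, closure_halfSpaces hU]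
  ext s
  refine forall₂_congr fun h' _ => ⟨fun hs => ?_, fun hs _ => hs⟩
  by_cases heq : h' = h
  · rw [heq, inner_add_frameMap hy hg]
  · exact hs heq

end facetRegion

/-! ### Facets of a cell and the half spaces presenting it -/

section cells

variable {n k : ℕ}

lemma Cell.isometry_param (σ : Cell n k) : Isometry σ.param := by
  refine Isometry.of_dist_eq fun s t => ?_
  rw [σ.param_eq, σ.param_eq, dist_add_left, dist_eq_norm, ← map_sub,
    norm_frameMap σ.orthonormal, dist_eq_norm]

lemma Cell.closure_carrier (σ : Cell n k) : closure σ.carrier = σ.param '' closure σ.region :=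
  σ.isometry_param.isClosedEmbedding.closure_image_eq _

lemma Cell.param_add_frameMap {l : ℕ} (σ : Cell n k) (y : E k) (g : Fin l → E k) (s : E l) :
    σ.param (y + frameMap g s) = σ.param y + frameMap (fun j => frameMap σ.frame (g j)) s := by
  rw [σ.param_eq, σ.param_eq, map_add, frameMap_comp, add_assoc]

/-- An affine map that sends an open set to the plane of a cell factors through this plane. -/
lemma Cell.exists_lift_affine {l : ℕ} (σ : Cell n k) {V : Set (E l)} (hV : IsOpen V)
    (hne : V.Nonempty) (c : E n) (f : Fin l → E n)
    (h : ∀ s ∈ V, c + frameMap f s ∈ Set.range σ.param) :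
    ∃ (y : E k) (g : Fin l → E k), c = σ.param y ∧ ∀ j, f j = frameMap σ.frame (g j) := by
  obtain ⟨s₀, hs₀⟩ := hne
  obtain ⟨δ, hδ, hball⟩ := Metric.isOpen_iff.1 hV s₀ hs₀
  obtain ⟨t₀, ht₀⟩ := h s₀ hs₀
  -- `f j` is a difference quotient of two points of the plane: `V` contains a ball of radius `δ`,
  -- so one may move by `δ / 2` in direction j.
  have hf : ∀ j, ∃ a, f j = frameMap σ.frame a := by
    intro j
    obtain ⟨t, ht⟩ := h (s₀ + (δ / 2) • EuclideanSpace.single j 1) (hball (by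
      rw [Metric.mem_ball, dist_self_add_left, norm_smul]
      simp only [PiLp.norm_single, norm_one, mul_one,
        Real.norm_of_nonneg (half_pos hδ).le]
      exact half_lt_self hδ))
    refine ⟨(δ / 2)⁻¹ • (t - t₀), ?_⟩
    rw [σ.param_eq] at ht ht₀
    have h1 : frameMap σ.frame (t - t₀) = (δ / 2) • f j := by
      rw [map_sub, ← frameMap_single f j, ← map_smul]
      have h2 : frameMap σ.frame t = c + frameMap f (s₀ + (δ / 2) • EuclideanSpace.single j 1)
        - σ.base := by rw [← ht]; abel
      have h3 : frameMap σ.frame t₀ = c + frameMap f s₀ - σ.base := by rw [← ht₀]; abel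
      rw [h2, h3, map_add]
      abel
    rw [map_smul, h1, smul_smul, inv_mul_cancel₀ (half_pos hδ).ne', one_smul]
  choose g hg using hf
  refine ⟨t₀ - frameMap g s₀, g, ?_, hg⟩
  have h1 : frameMap f s₀ = frameMap σ.frame (frameMap g s₀) := by
    rw [frameMap_comp]
    congr 2
    exact funext hg
  rw [σ.param_eq] at ht₀ ⊢
  rw [map_sub, ← h1, ← add_sub_assoc, ht₀, add_sub_cancel_right]

lemma orthonormal_of_frameMap {l : ℕ} {e : Fin k → E n} (he : Orthonormal ℝ e)
    {f : Fin l → E k} (hf : Orthonormal ℝ fun j => frameMap e (f j)) : Orthonormal ℝ f := by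
  rw [orthonormal_iff_ite] at hf ⊢
  intro i j
  rw [← hf i j, inner_frameMap he]

lemma orthonormal_frameMap_comp {l : ℕ} {e : Fin k → E n} (he : Orthonormal ℝ e)
    {f : Fin l → E k} (hf : Orthonormal ℝ f) : Orthonormal ℝ fun j => frameMap e (f j) := by
  rw [orthonormal_iff_ite] at hf ⊢
  intro i j
  rw [← hf i j, inner_frameMap he]

lemma frameMap_injective {e : Fin k → E n} (he : Orthonormal ℝ e) :
    Function.Injective (frameMap e) := by
  refine (injective_iff_map_eq_zero _).2 fun x hx => ?_
  rwa [← norm_eq_zero, norm_frameMap he, norm_eq_zero] at hx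

variable {σ : Cell n (k + 1)} {H : Finset (E (k + 1) × ℝ)}

/-- Every facet of a cell is cut out by one of the half spaces that present the cell. -/
lemma IsFacet.exists_halfSpace (hunit : ∀ h ∈ H, ‖h.1‖ = 1) (hσ : σ.region = halfSpaces H)
    {ν : E n} {τ : Cell n k} (hτ : IsFacet σ ν τ) :
    ∃ h ∈ H, ∃ (y : E (k + 1)) (g : Fin k → E (k + 1)), ν = frameMap σ.frame h.1 ∧
      ⟪h.1, y⟫ = h.2 ∧ Orthonormal ℝ (Fin.cons h.1 g : Fin (k + 1) → E (k + 1)) ∧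
      τ.base = σ.param y ∧ (∀ j, τ.frame j = frameMap σ.frame (g j)) ∧
      τ.region = facetRegion H h y g := by
  obtain ⟨hspan, hν, c, hlt, hclos⟩ := hτ
  have hUne : (halfSpaces H).Nonempty := hσ ▸ σ.isOpenCell.2.1
  obtain ⟨a', ha'⟩ := (Submodule.mem_span_range_iff_exists_fun ℝ).1 hspan
  obtain ⟨a, rfl⟩ : ∃ a, ν = frameMap σ.frame a :=
    ⟨WithLp.toLp 2 a', by rw [frameMap_apply]; exact ha'.symm⟩
  rw [norm_frameMap σ.orthonormal] at hν
  have hmem : ∀ s ∈ closure τ.region, τ.param s ∈ closure σ.carrier ∧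
      ⟪frameMap σ.frame a, τ.param s⟫ = c := by
    intro s hs
    have : τ.param s ∈ closure τ.carrier := by
      rw [τ.closure_carrier]; exact Set.mem_image_of_mem _ hs
    rw [hclos] at this
    exact this
  obtain ⟨y, g, hy, hg⟩ := σ.exists_lift_affine τ.isOpenCell.isOpen τ.isOpenCell.2.1 τ.base τ.frame
    (fun s hs => by
      have := (hmem s (subset_closure hs)).1
      rw [σ.closure_carrier] at this
      rw [← τ.param_eq]
      exact Set.mem_range_of_mem_image _ _ this)
  have hparam : ∀ s, τ.param s = σ.param (y + frameMap g s) := fun s => by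
    rw [σ.param_add_frameMap, τ.param_eq, hy]
    congr 3
    exact funext hg
  have hinner : ∀ t, ⟪frameMap σ.frame a, σ.param t⟫ =
      ⟪frameMap σ.frame a, σ.base⟫ + ⟪a, t⟫ := fun t => by
    rw [σ.param_eq, inner_add_right, inner_frameMap σ.orthonormal]
  -- The offset of the supporting hyperplane in the coordinates of `σ`; the half space sought is
  -- `(a, b)`.
  set b : ℝ := c - ⟪frameMap σ.frame a, σ.base⟫ with hb
  have hc : ∀ s ∈ τ.region, ⟪a, y + frameMap g s⟫ = b := fun s hs => by
    have := (hmem s (subset_closure hs)).2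
    rw [hparam, hinner] at this
    rw [hb]; linarith
  have hag : ∀ j, ⟪a, g j⟫ = 0 := by
    intro j
    obtain ⟨s₀, hs₀⟩ := τ.isOpenCell.2.1
    obtain ⟨δ, hδ, hball⟩ := Metric.isOpen_iff.1 τ.isOpenCell.isOpen s₀ hs₀
    have h1 := hc (s₀ + (δ / 2) • EuclideanSpace.single j 1) (hball (by
      rw [Metric.mem_ball, dist_self_add_left, norm_smul]
      simp only [PiLp.norm_single, norm_one, mul_one,
        Real.norm_of_nonneg (half_pos hδ).le]
      exact half_lt_self hδ))
    have h2 := hc s₀ hs₀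
    rw [map_add, map_smul, frameMap_single, inner_add_right, inner_add_right,
      real_inner_smul_right] at h1
    rw [inner_add_right] at h2
    have : δ / 2 * ⟪a, g j⟫ = 0 := by linarith
    exact (mul_eq_zero.1 this).resolve_left (half_pos hδ).ne'
  have hay : ⟪a, y⟫ = b := by
    obtain ⟨s₀, hs₀⟩ := τ.isOpenCell.2.1
    have := hc s₀ hs₀
    rw [inner_add_right, frameMap_apply, inner_sum] at this
    simpa [real_inner_smul_right, hag] using this
  have hgo : Orthonormal ℝ g := orthonormal_of_frameMap σ.orthonormal (by
    have := τ.orthonormal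
    rwa [show τ.frame = fun j => frameMap σ.frame (g j) from funext hg] at this)
  have hon : Orthonormal ℝ (Fin.cons a g : Fin (k + 1) → E (k + 1)) :=
    orthonormal_cons_iff.2 ⟨hν, hag, hgo⟩
  have hUlt : ∀ t ∈ halfSpaces H, ⟪a, t⟫ < b := fun t ht => by
    have := hlt (σ.param t) (Set.mem_image_of_mem _ (hσ ▸ ht))
    rw [hinner] at this
    rw [hb]; linarith
  have hcl : ∀ s, s ∈ closure τ.region ↔ y + frameMap g s ∈ closure (halfSpaces H) := by
    intro s
    constructor
    · intro hs
      have := (hmem s hs).1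
      rw [σ.closure_carrier, hσ, hparam] at this
      exact (σ.isometry_param.injective.mem_set_image).1 this
    · intro hs
      have : τ.param s ∈ closure τ.carrier := by
        rw [hclos, σ.closure_carrier, hσ, hparam]
        refine ⟨Set.mem_image_of_mem _ hs, ?_⟩
        change ⟪_, _⟫ = c
        rw [hinner, inner_add_frameMap (h := (a, b)) hay hag, hb]
        ring
      rw [τ.closure_carrier] at this
      exact (τ.isometry_param.injective.mem_set_image).1 this
  -- a point of the facet on no other hyperplane
  obtain ⟨x₀, hx₀⟩ := hUne
  obtain ⟨s₁, hs₁, hs₁'⟩ : ∃ s ∈ τ.region, ∀ h' ∈ H, h' ≠ (a, b) →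
      ⟪h'.1, y + frameMap g s⟫ ≠ h'.2 := by
    classical
    have hnull : ∀ᵐ s : E k, ∀ h' ∈ H.filter (· ≠ (a, b)), ⟪h'.1, y + frameMap g s⟫ ≠ h'.2 := by
      refine (ae_ball_iff (Finset.countable_toSet _)).2 fun h' hh' => ?_
      have hh'' := Finset.mem_filter.1 hh'
      rw [ae_iff]
      simpa using volume_inter_hyperplane_eq_zero (h := (a, b)) hon hay (hunit h' hh''.1) hh''.2
        (hUlt x₀ hx₀) (hx₀ h' hh''.1)
    by_contra! hcon
    refine τ.isOpenCell.volume_pos.ne' (measure_mono_null (fun s hs => ?_) (ae_iff.1 hnull))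
    obtain ⟨h', hh', hne', heq⟩ := hcon s hs
    exact fun hall => hall h' (Finset.mem_filter.2 ⟨hh', hne'⟩) heq
  have hs₁le : ∀ h' ∈ H, ⟪h'.1, y + frameMap g s₁⟫ ≤ h'.2 := by
    have := (hcl s₁).1 (subset_closure hs₁)
    rwa [closure_halfSpaces ⟨x₀, hx₀⟩] at this
  have hs₁F : s₁ ∈ facetRegion H (a, b) y g := fun h' hh' hne' =>
    lt_of_le_of_ne (hs₁le h' hh') (hs₁' h' hh' hne')
  -- Otherwise the point `s₁` would satisfy every inequality of `H` strictly and so lie in the open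
  -- cell, although it lies on the supporting hyperplane.
  have habH : (a, b) ∈ H := by
    by_contra hnot
    refine (hUlt (y + frameMap g s₁) fun h' hh' => hs₁F h' hh' ?_).ne (hc s₁ hs₁)
    rintro rfl
    exact hnot hh'
  refine ⟨(a, b), habH, y, g, rfl, hay, hon, hy, hg, ?_⟩
  have hF := closure_facetRegion_eq ⟨s₁, hs₁F⟩ ⟨x₀, hx₀⟩ hay hag
  have hclosure : closure τ.region = closure (facetRegion H (a, b) y g) := by
    rw [hF]
    ext s
    exact hcl s
  have hFo := isOpenPolyhedron_facetRegion (H := H) (h := (a, b)) (y := y) (g := g)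
  obtain ⟨K, hK⟩ := hFo
  have hFopen : IsOpen (facetRegion H (a, b) y g) := hK ▸ isOpen_halfSpaces K
  have hFconv : Convex ℝ (facetRegion H (a, b) y g) := hK ▸ convex_halfSpaces K
  -- A facet is specified only through its closure; an open convex set is recovered from it as the
  -- interior.
  have e1 := τ.isOpenCell.convex.interior_closure_eq_interior_of_nonempty_interior
    (by rw [τ.isOpenCell.isOpen.interior_eq]; exact τ.isOpenCell.2.1)
  have e2 := hFconv.interior_closure_eq_interior_of_nonempty_interior
    (by rw [hFopen.interior_eq]; exact ⟨s₁, hs₁F⟩)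
  rw [τ.isOpenCell.isOpen.interior_eq] at e1
  rw [hFopen.interior_eq] at e2
  rw [← e1, ← e2, hclosure]

lemma exists_orthonormal_cons {a : E (k + 1)} (ha : ‖a‖ = 1) :
    ∃ g : Fin k → E (k + 1), Orthonormal ℝ (Fin.cons a g : Fin (k + 1) → E (k + 1)) := by
  have : Fact (Module.finrank ℝ (E (k + 1)) = k + 1) := ⟨finrank_euclideanSpace_fin⟩
  have ha0 : a ≠ 0 := by
    rintro rfl
    simp at ha
  let B := OrthonormalBasis.fromOrthogonalSpanSingleton (𝕜 := ℝ) k ha0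
  refine ⟨fun i => (B i : E (k + 1)), orthonormal_cons_iff.2 ⟨ha, fun i => ?_, ?_⟩⟩
  · exact (Submodule.mem_orthogonal_singleton_iff_inner_right).1 (B i).2
  · exact B.orthonormal.comp_linearIsometry (Submodule.subtypeₗᵢ _)

/-- A half space with nonempty facet region cuts out a facet. -/
lemma mem_facetNormals_of_facetRegion_nonempty (hσ : σ.region = halfSpaces H)
    {h : E (k + 1) × ℝ} (hh : h ∈ H) {y : E (k + 1)} {g : Fin k → E (k + 1)}
    (hy : ⟪h.1, y⟫ = h.2) (hg : Orthonormal ℝ (Fin.cons h.1 g : Fin (k + 1) → E (k + 1)))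
    (hne : (facetRegion H h y g).Nonempty) : frameMap σ.frame h.1 ∈ facetNormals σ := by
  obtain ⟨ha, hag, hgo⟩ := orthonormal_cons_iff.1 hg
  have hUne : (halfSpaces H).Nonempty := hσ ▸ σ.isOpenCell.2.1
  have hF := closure_facetRegion_eq hne hUne hy hag
  have hcell : IsOpenCell (facetRegion H h y g) := by
    refine isOpenPolyhedron_facetRegion.isOpenCell hne ?_
    have hb : Bornology.IsBounded (closure (halfSpaces H)) :=
      (hσ ▸ σ.isOpenCell.2.2 : Bornology.IsBounded (halfSpaces H)).closure
    obtain ⟨R, hR⟩ := hb.exists_norm_le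
    refine isBounded_iff_forall_norm_le.2 ⟨R + ‖y‖, fun s hs => ?_⟩
    have h1 : s ∈ closure (facetRegion H h y g) := subset_closure hs
    rw [hF] at h1
    rw [← norm_frameMap hgo, ← add_sub_cancel_left y (frameMap g s)]
    exact (norm_sub_le _ _).trans (by gcongr; exact hR _ h1)
  let τ : Cell n k := ⟨σ.param y, fun j => frameMap σ.frame (g j),
    orthonormal_frameMap_comp σ.orthonormal hgo, facetRegion H h y g, hcell⟩
  have hparam : ∀ s, τ.param s = σ.param (y + frameMap g s) := fun s => by
    rw [σ.param_add_frameMap, τ.param_eq]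
  have hinner : ∀ t, ⟪frameMap σ.frame h.1, σ.param t⟫ =
      ⟪frameMap σ.frame h.1, σ.base⟫ + ⟪h.1, t⟫ := fun t => by
    rw [σ.param_eq, inner_add_right, inner_frameMap σ.orthonormal]
  refine ⟨τ, ?_, by rw [norm_frameMap σ.orthonormal, ha],
    ⟪frameMap σ.frame h.1, σ.base⟫ + h.2, ?_, ?_⟩
  · rw [frameMap_apply]
    exact Submodule.sum_mem _ fun i _ =>
      Submodule.smul_mem _ _ (Submodule.subset_span (Set.mem_range_self i))
  · rintro _ ⟨t, ht, rfl⟩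
    rw [hinner]
    rw [hσ] at ht
    have := ht h hh
    linarith
  · rw [τ.closure_carrier, σ.closure_carrier, hσ]
    change τ.param '' closure (facetRegion H h y g) = _
    rw [hF]
    ext x
    constructor
    · rintro ⟨s, hs, rfl⟩
      refine ⟨⟨y + frameMap g s, hs, (hparam s).symm⟩, ?_⟩
      change ⟪_, _⟫ = _
      rw [hparam, hinner, inner_add_frameMap hy hag]
    · rintro ⟨⟨t, ht, rfl⟩, hx⟩
      change ⟪_, _⟫ = _ at hx
      rw [hinner] at hx
      -- Decompose `t - y` into normal and tangential parts. Since `t` lies on the hyperplane, the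
      -- normal coordinate `p 0` vanishes.
      obtain ⟨p, hp⟩ := frameMap_surjective hg (t - y)
      rw [← consE_tailE p, frameMap_cons_consE] at hp
      change p 0 • h.1 + frameMap g (tailE k p) = t - y at hp
      have hp0 : p 0 = 0 := by
        have h1 : ⟪h.1, p 0 • h.1 + frameMap g (tailE k p)⟫ = ⟪h.1, t - y⟫ := by rw [hp]
        have h2 := inner_add_frameMap (h := h) hy hag (tailE k p)
        rw [inner_add_right] at h2
        rw [inner_add_right, inner_sub_right, real_inner_smul_right, real_inner_self_eq_norm_sq,
          ha] at h1
        linarith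
      rw [hp0, zero_smul, zero_add] at hp
      have ht' : y + frameMap g (tailE k p) = t := by rw [hp]; abel
      refine ⟨tailE k p, ?_, by rw [hparam, ht']⟩
      change _ ∈ closure _
      rwa [ht']

end cells

/-! ### The Stokes theorem for cells -/

lemma linearize_single {α A : Type*} [AddCommGroup A] (f : α → A) (a : α) (z : ℤ) :
    linearize f (Finsupp.single a z) = z • f a := by
  simp [linearize]

section stokes

variable {n k : ℕ}

@[simp] lemma formalIntegral_single (ω : E n → E n [⋀^Fin k]→L[ℝ] ℝ) (τ : Cell n k) :
    formalIntegral ω (single τ) = τ.integral ω := by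
  rw [formalIntegral, single, linearize_single, one_smul]

lemma inner_euclideanSingle {m : ℕ} (a : E m) (i : Fin m) :
    ⟪a, EuclideanSpace.single i 1⟫ = a i := by
  rw [PiLp.inner_apply, Finset.sum_eq_single i]
  · simp
  · intro j _ hj
    simp [hj]
  · simp

/-- Taking inner products with an orthonormal frame recovers coordinates. Orientation signs thus
become signs of the same determinants by which forms of top degree are multiplied. -/
lemma relSign_frameMap {m : ℕ} {e : Fin m → E n} (he : Orthonormal ℝ e) (f : Fin m → E m) :
    relSign e (fun j => frameMap e (f j)) = (SignType.sign (frameMatrix f).det : ℤ) := by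
  rw [relSign]
  congr 3
  ext i j
  simp only [Matrix.of_apply, frameMatrix]
  rw [← frameMap_single e i, inner_frameMap he, real_inner_comm, inner_euclideanSingle]

/-- The form `ν ∧ ω` on an orthonormal frame, for a vector `ν` identified with a covector. -/
lemma sum_neg_one_pow_mul_removeNth (ω : E n [⋀^Fin k]→L[ℝ] ℝ) {e : Fin (k + 1) → E n}
    (he : Orthonormal ℝ e) {a : E (k + 1)} {g : Fin k → E (k + 1)}
    (hg : Orthonormal ℝ (Fin.cons a g : Fin (k + 1) → E (k + 1))) :
    ∑ i : Fin (k + 1), (-1) ^ (i : ℕ) * a i * ω (i.removeNth e) =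
      relSign e (Fin.cons (frameMap e a) fun j => frameMap e (g j)) *
        ω fun j => frameMap e (g j) := by
  obtain ⟨ha, hag, hgo⟩ := orthonormal_cons_iff.1 hg
  -- This is the wedge of the covector of the normal with `ω`. Evaluated on `e` it gives the
  -- alternating sum; on the adapted frame only the term of the normal survives. The two values
  -- differ by a determinant ±1, which is the orientation sign.
  set φ := ContinuousAlternatingMap.alternatizeUncurryFin
    ((innerSL ℝ (frameMap e a)).smulRight ω) with hφ
  have hcons : (Fin.cons (frameMap e a) fun j => frameMap e (g j) : Fin (k + 1) → E n) =
      fun j => frameMap e ((Fin.cons a g : Fin (k + 1) → E (k + 1)) j) := by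
    ext1 j
    refine Fin.cases rfl (fun j => rfl) j
  have h1 : φ e = ∑ i : Fin (k + 1), (-1) ^ (i : ℕ) * a i * ω (i.removeNth e) := by
    rw [hφ, ContinuousAlternatingMap.alternatizeUncurryFin_apply]
    refine Finset.sum_congr rfl fun i _ => ?_
    have : ⟪frameMap e a, e i⟫ = a i := by
      rw [← frameMap_single e i, inner_frameMap he, inner_euclideanSingle]
    simp [this, mul_assoc]
  have h2 : φ (Fin.cons (frameMap e a) fun j => frameMap e (g j)) =
      ω fun j => frameMap e (g j) := by
    rw [hφ, ContinuousAlternatingMap.alternatizeUncurryFin_apply, Fin.sum_univ_succ]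
    simp [inner_frameMap he, hag, norm_frameMap he, ha]
  rw [hcons, map_frameMap_eq_det_mul] at h2
  rw [← h1, ← h2, hcons, relSign_frameMap he]
  have hdet := abs_det_frameMatrix_of_orthonormal hg
  rcases eq_or_eq_neg_of_abs_eq hdet with h | h <;> rw [h] <;> simp

/-- **The Stokes theorem** for cells. -/
theorem formalIntegral_cellBoundary (σ : Cell n (k + 1)) {ω : E n → E n [⋀^Fin k]→L[ℝ] ℝ}
    (hω : ContDiff ℝ 1 ω) :
    formalIntegral ω (cellBoundary σ) = σ.integral (extDeriv ω) := by
  classical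
  obtain ⟨H, hunit, hσ⟩ := σ.isOpenCell.exists_unit_normals
  have hUne : (halfSpaces H).Nonempty := hσ ▸ σ.isOpenCell.2.1
  have hUb : Bornology.IsBounded (halfSpaces H) := hσ ▸ σ.isOpenCell.2.2
  -- Assign to each facet a half space of the fixed presentation. The half space determines the
  -- normal, so there are finitely many facets and the `finsum` in the boundary is a genuine sum.
  have hdata := fun ν : facetNormals σ => IsFacet.exists_halfSpace hunit hσ ν.2.choose_spec
  choose hs hsH ys gs hν hys hgs hbase hframe hregion using hdata
  have hinj : Function.Injective hs := fun ν ν' hh => Subtype.ext (by rw [hν ν, hν ν', hh])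
  have : Finite (facetNormals σ) := Finite.of_injective (β := H) (fun ν => ⟨hs ν, hsH ν⟩)
    fun ν ν' hh => hinj (congrArg Subtype.val hh)
  have := Fintype.ofFinite (facetNormals σ)
  -- coordinates on the hyperplanes of all half spaces
  have hex : ∀ h : E (k + 1) × ℝ, ∃ (y : E (k + 1)) (g : Fin k → E (k + 1)),
      (h ∈ H → ⟪h.1, y⟫ = h.2 ∧ Orthonormal ℝ (Fin.cons h.1 g : Fin (k + 1) → E (k + 1))) ∧
      ∀ ν, hs ν = h → y = ys ν ∧ g = gs ν := by
    intro h
    by_cases hr : ∃ ν, hs ν = h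
    · obtain ⟨ν, rfl⟩ := hr
      exact ⟨ys ν, gs ν, fun _ => ⟨hys ν, hgs ν⟩, fun ν' hν' => by rw [hinj hν']; exact ⟨rfl, rfl⟩⟩
    · by_cases hh : h ∈ H
      · obtain ⟨g, hg⟩ := exists_orthonormal_cons (hunit h hh)
        refine ⟨h.2 • h.1, g, fun _ => ⟨?_, hg⟩, fun ν hν' => absurd ⟨ν, hν'⟩ hr⟩
        rw [real_inner_smul_right, real_inner_self_eq_norm_sq, hunit h hh]
        ring
      · exact ⟨0, fun _ => 0, fun hh' => absurd hh' hh, fun ν hν' => absurd ⟨ν, hν'⟩ hr⟩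
  choose y g hyg hygν using hex
  have hf : ∀ i : Fin (k + 1), ContDiff ℝ 1 fun t => ω (σ.param t) (i.removeNth σ.frame) := by
    intro i
    have h1 : ContDiff ℝ 1 σ.param := by
      rw [show σ.param = fun t => σ.base + frameMap σ.frame t from funext σ.param_eq]
      fun_prop
    exact (ContinuousAlternatingMap.apply ℝ (E n) ℝ (i.removeNth σ.frame)).contDiff.comp
      (hω.comp h1)
  have hderiv : ∀ t, extDeriv ω (σ.param t) σ.frame = ∑ i : Fin (k + 1), (-1) ^ (i : ℕ) *
      fderiv ℝ (fun t => ω (σ.param t) (i.removeNth σ.frame)) t (EuclideanSpace.single i 1) := by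
    intro t
    rw [extDeriv_apply (hω.differentiable one_ne_zero _)]
    refine Finset.sum_congr rfl fun i _ => ?_
    have h1 : HasFDerivAt σ.param (frameMap σ.frame) t := by
      rw [show σ.param = fun t => σ.base + frameMap σ.frame t from funext σ.param_eq]
      exact (frameMap σ.frame).hasFDerivAt.const_add _
    have h2 : DifferentiableAt ℝ (fun x => ω x (i.removeNth σ.frame)) (σ.param t) :=
      ((ContinuousAlternatingMap.apply ℝ (E n) ℝ (i.removeNth σ.frame)).differentiable.comp
        (hω.differentiable one_ne_zero)) _
    have h3 : fderiv ℝ (fun t => ω (σ.param t) (i.removeNth σ.frame)) t =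
        (fderiv ℝ (fun x => ω x (i.removeNth σ.frame)) (σ.param t)).comp (frameMap σ.frame) :=
      (h2.hasFDerivAt.comp t h1).fderiv
    rw [h3, ContinuousLinearMap.comp_apply, frameMap_single]
    simp
  obtain ⟨R, hR⟩ := hUb.subset_closedBall 0
  have hint : ∀ i : Fin (k + 1), IntegrableOn (fun t => (-1) ^ (i : ℕ) *
      fderiv ℝ (fun t => ω (σ.param t) (i.removeNth σ.frame)) t (EuclideanSpace.single i 1))
      (halfSpaces H) := fun i =>
    ((continuous_const.mul (((hf i).continuous_fderiv one_ne_zero).clm_apply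
      continuous_const)).continuousOn.integrableOn_compact (isCompact_closedBall 0 R)).mono_set hR
  have hbd : ∀ h ∈ H, Bornology.IsBounded (facetRegion H h (y h) (g h)) := by
    intro h hh
    obtain ⟨hy, hg⟩ := hyg h hh
    obtain ⟨-, hag, hgo⟩ := orthonormal_cons_iff.1 hg
    rcases Set.eq_empty_or_nonempty (facetRegion H h (y h) (g h)) with h0 | hne
    · rw [h0]; exact Bornology.isBounded_empty
    obtain ⟨R, hR⟩ := hUb.closure.exists_norm_le
    refine isBounded_iff_forall_norm_le.2 ⟨R + ‖y h‖, fun s hs => ?_⟩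
    have h1 : s ∈ closure (facetRegion H h (y h) (g h)) := subset_closure hs
    rw [closure_facetRegion_eq hne hUne hy hag] at h1
    rw [← norm_frameMap hgo, ← add_sub_cancel_left (y h) (frameMap (g h) s)]
    exact (norm_sub_le _ _).trans (by gcongr; exact hR _ h1)
  -- The contribution of one half space: the integrand is the wedge of its normal with `ω`,
  -- evaluated on the frame of the cell. Half spaces that cut out no facet will contribute 0.
  set Φ : E (k + 1) × ℝ → ℝ := fun h => ∫ s in facetRegion H h (y h) (g h),
    ∑ i : Fin (k + 1), (-1) ^ (i : ℕ) * h.1 i *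
      ω (σ.param (y h + frameMap (g h) s)) (i.removeNth σ.frame) with hΦ
  have hLHS : σ.integral (extDeriv ω) = ∑ h ∈ H, Φ h := by
    have hΦ' : ∀ h ∈ H, Φ h = ∑ i : Fin (k + 1), (-1) ^ (i : ℕ) *
        (⟪h.1, EuclideanSpace.single i 1⟫ * ∫ s in facetRegion H h (y h) (g h),
          ω (σ.param (y h + frameMap (g h) s)) (i.removeNth σ.frame)) := by
      intro h hh
      simp only [hΦ]
      rw [integral_finsetSum]
      · refine Finset.sum_congr rfl fun i _ => ?_
        rw [integral_const_mul, inner_euclideanSingle, mul_assoc]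
      · intro i _
        obtain ⟨R, hR⟩ := (hbd h hh).subset_closedBall 0
        refine ((continuous_const.mul ((hf i).continuous.comp (g := fun t => ω (σ.param t)
          (i.removeNth σ.frame)) (f := fun s => y h + frameMap (g h) s)
          (by fun_prop))).continuousOn.integrableOn_compact
          (isCompact_closedBall 0 R)).mono_set hR
    rw [Finset.sum_congr rfl hΦ', Finset.sum_comm, Cell.integral, hσ]
    simp_rw [hderiv]
    rw [integral_finsetSum _ fun i _ => hint i]
    refine Finset.sum_congr rfl fun i _ => ?_
    rw [integral_const_mul, integral_fderiv_halfSpaces hunit hUne hUb (hf i) _ y g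
      (fun h hh => (hyg h hh).1) (fun h hh => (hyg h hh).2), Finset.mul_sum]
  have hterm : ∀ ν : facetNormals σ, formalIntegral ω
      (relSign σ.frame (Fin.cons (ν : E n) (facet σ ν).frame) • single (facet σ ν)) =
        Φ (hs ν) := by
    intro ν
    have hfr : (facet σ ν).frame = fun j => frameMap σ.frame (gs ν j) := funext (hframe ν)
    have hpar : ∀ s, (facet σ ν).param s = σ.param (ys ν + frameMap (gs ν) s) := fun s => by
      rw [σ.param_add_frameMap, Cell.param_eq, hfr]
      congr 1
      exact hbase ν
    have hreg : (facet σ ν).region = facetRegion H (hs ν) (ys ν) (gs ν) := hregion ν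
    obtain ⟨e1, e2⟩ := hygν (hs ν) ν rfl
    rw [map_zsmul, formalIntegral_single, zsmul_eq_mul, Cell.integral, ← integral_const_mul]
    simp only [hΦ, e1, e2]
    rw [hreg]
    refine integral_congr_ae (Eventually.of_forall fun s => ?_)
    simp only
    rw [sum_neg_one_pow_mul_removeNth _ σ.orthonormal (hgs ν), hpar, hfr, ← hν ν]
  rw [hLHS, cellBoundary, finsum_eq_sum_of_fintype, map_sum, Finset.sum_congr rfl fun ν _ => hterm ν,
    ← Finset.sum_image (s := Finset.univ) (g := hs) (f := Φ) (fun ν _ ν' _ hh => hinj hh)]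
  refine Finset.sum_subset (fun h hh => ?_) fun h hh hnot => ?_
  · obtain ⟨ν, -, rfl⟩ := Finset.mem_image.1 hh
    exact hsH ν
  -- A nonempty region would make the normal of `h` a facet normal, so a half space `hs ν` with this
  -- normal is assigned to a facet. If it differed from `h`, points of the two facet regions would
  -- show each offset to be strictly smaller than the other.
  · have hempty : facetRegion H h (y h) (g h) = ∅ := by
      by_contra hne
      have hne := Set.nonempty_iff_ne_empty.2 hne
      obtain ⟨hy, hg⟩ := hyg h hh
      let ν : facetNormals σ :=
        ⟨_, mem_facetNormals_of_facetRegion_nonempty hσ hh hy hg hne⟩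
      have hfst : (hs ν).1 = h.1 := (frameMap_injective σ.orthonormal (hν ν)).symm
      refine hnot (Finset.mem_image.2 ⟨ν, Finset.mem_univ _, ?_⟩)
      by_contra hneq
      obtain ⟨s, hs1⟩ := hne
      obtain ⟨s', hs2⟩ := (hregion ν) ▸ (facet σ ν).isOpenCell.2.1
      have h1 := hs1 (hs ν) (hsH ν) hneq
      have h2 := hs2 h hh (Ne.symm hneq)
      rw [hfst, inner_add_frameMap hy (orthonormal_cons_iff.1 hg).2.1] at h1
      rw [← hfst, inner_add_frameMap (hys ν) (orthonormal_cons_iff.1 (hgs ν)).2.1] at h2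
      exact lt_asymm h1 h2
    simp only [hΦ, hempty, setIntegral_empty]

/-- **The Stokes theorem** for formal sums of cells. -/
theorem formalIntegral_boundary (S : FormalChain n (k + 1)) {ω : E n → E n [⋀^Fin k]→L[ℝ] ℝ}
    (hω : ContDiff ℝ 1 ω) :
    formalIntegral ω (boundary S) = formalIntegral (extDeriv ω) S := by
  have : (formalIntegral ω).comp boundary = formalIntegral (extDeriv ω) := by
    ext σ
    simp only [AddMonoidHom.comp_apply, Finsupp.singleAddHom_apply, boundary, formalIntegral,
      linearize_single, one_smul]
    exact formalIntegral_cellBoundary σ hω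
  exact DFunLike.congr_fun this S

end stokes

/-! ### Prisms -/

section prism

variable {n k : ℕ}

/-- The product of the unit interval with the region of a cell. -/
def Cell.prismRegion (τ : Cell n k) : Set (E (k + 1)) := consE '' (Set.Ioo (0 : ℝ) 1 ×ˢ τ.region)

lemma Cell.isOpenCell_prismRegion (τ : Cell n k) : IsOpenCell τ.prismRegion :=
  τ.isOpenCell.prod_Ioo

lemma Cell.prismRegion_eq (τ : Cell n k) :
    τ.prismRegion = consEquiv k '' (Set.Ioo (0 : ℝ) 1 ×ˢ τ.region) := by
  simp only [Cell.prismRegion, consEquiv_apply]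

lemma Cell.volume_prismRegion (τ : Cell n k) : volume τ.prismRegion = volume τ.region := by
  rw [τ.prismRegion_eq, MeasurableEquiv.image_eq_preimage_symm,
    (consEquiv_measurePreserving k).symm.measure_preimage_equiv, Measure.prod_prod]
  simp

/-- The parametrization starts at the far end `τ + v` and runs along `-v`, so that its frame is the
one orienting the prism. -/
lemma prismParam_consE (τ : Cell n k) (v : E n) (p : ℝ × E k) :
    τ.base + v + frameMap (Fin.cons (-v) τ.frame : Fin (k + 1) → E n) (consE p) =
      τ.param p.2 + (1 - p.1) • v := by
  rw [frameMap_cons_consE, τ.param_eq]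
  module

lemma orbit_eq_image (τ : Cell n k) (v : E n) :
    orbit τ v = (fun x => τ.base + v +
      frameMap (Fin.cons (-v) τ.frame : Fin (k + 1) → E n) x) '' τ.prismRegion := by
  rw [Cell.prismRegion, Set.image_image]
  simp only [prismParam_consE]
  ext z
  constructor
  · rintro ⟨_, ⟨s, hs, rfl⟩, t, ht, rfl⟩
    exact ⟨(1 - t, s), ⟨⟨by linarith [ht.2], by linarith [ht.1]⟩, hs⟩, by simp⟩
  · rintro ⟨⟨t, s⟩, ⟨ht, hs⟩, rfl⟩
    exact ⟨τ.param s, ⟨s, hs, rfl⟩, 1 - t, ⟨by linarith [ht.2], by linarith [ht.1]⟩, rfl⟩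

/-- The orbit of a cell along a transverse vector is a cell. -/
lemma exists_carrier_eq_orbit (τ : Cell n k) (v : E n)
    (hli : LinearIndependent ℝ (Fin.cons (-v) τ.frame : Fin (k + 1) → E n)) :
    ∃ ρ : Cell n (k + 1), ρ.carrier = orbit τ v := by
  set F : Fin (k + 1) → E n := Fin.cons (-v) τ.frame with hF
  set W := Submodule.span ℝ (Set.range F) with hW
  have hrank : Module.finrank ℝ W = k + 1 := by
    rw [hW, finrank_span_eq_card hli, Fintype.card_fin]
  -- A cell needs an orthonormal frame, whereas `v` may be oblique to `τ`. In the new basis the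
  -- prism is an invertible linear image of a product, hence again a polyhedron.
  let B := (stdOrthonormalBasis ℝ W).reindex (finCongr hrank)
  let e : Fin (k + 1) → E n := fun i => (B i : E n)
  have he : Orthonormal ℝ e := B.orthonormal.comp_linearIsometry (Submodule.subtypeₗᵢ _)
  have hfe : ∀ j, ∃ a, F j = frameMap e a := by
    intro j
    let w : W := ⟨F j, Submodule.subset_span (Set.mem_range_self j)⟩
    refine ⟨WithLp.toLp 2 fun i => B.repr w i, ?_⟩
    have := congrArg (Subtype.val) (B.sum_repr w)
    rw [frameMap_apply]
    rw [Submodule.coe_sum] at this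
    exact this.symm
  choose f hf using hfe
  have hcomp : ∀ x, frameMap F x = frameMap e (frameMap f x) := fun x => by
    rw [frameMap_comp]
    congr 2
    exact funext hf
  have hinj : Function.Injective (frameMap f : E (k + 1) →ₗ[ℝ] E (k + 1)) := by
    refine (injective_iff_map_eq_zero _).2 fun x hx => ?_
    have h0 : frameMap f x = 0 := hx
    have h1 : frameMap F x = 0 := by rw [hcomp, h0, map_zero]
    rw [frameMap_apply] at h1
    ext i
    exact Fintype.linearIndependent_iff.1 hli (fun i => x i) h1 i
  let A : E (k + 1) ≃L[ℝ] E (k + 1) :=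
    (LinearEquiv.ofInjectiveEndo (frameMap f : E (k + 1) →ₗ[ℝ] E (k + 1))
      hinj).toContinuousLinearEquiv
  have hA : ∀ x, A x = frameMap f x := fun x => rfl
  have hreg : frameMap f '' τ.prismRegion =
      (fun x => 0 + (A.symm : E (k + 1) →L[ℝ] E (k + 1)) x) ⁻¹' τ.prismRegion := by
    ext x
    simp only [Set.mem_preimage, zero_add]
    constructor
    · rintro ⟨z, hz, rfl⟩
      rw [← hA]
      simpa using hz
    · intro hx
      exact ⟨A.symm x, hx, by rw [← hA]; simp⟩
  have hcell : IsOpenCell (frameMap f '' τ.prismRegion) := by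
    refine IsOpenPolyhedron.isOpenCell ?_ (τ.isOpenCell_prismRegion.2.1.image _)
      ((frameMap f).lipschitz.isBounded_image τ.isOpenCell_prismRegion.2.2)
    rw [hreg]
    exact τ.isOpenCell_prismRegion.isOpenPolyhedron.preimage_affine 0 _
  let ρ : Cell n (k + 1) := ⟨τ.base + v, e, he, _, hcell⟩
  refine ⟨ρ, ?_⟩
  rw [orbit_eq_image, Cell.carrier]
  change ρ.param '' (frameMap f '' τ.prismRegion) = _
  rw [Set.image_image]
  refine Set.image_congr fun x _ => ?_
  rw [ρ.param_eq, hcomp]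

/-- Linear coordinates on a cell that occupies an orbit. -/
lemma exists_prism_coordinates {τ : Cell n k} {v : E n} {ρ : Cell n (k + 1)}
    (hρ : ρ.carrier = orbit τ v) :
    ∃ (y : E (k + 1)) (f : Fin (k + 1) → E (k + 1)), τ.base + v = ρ.param y ∧
      (Fin.cons (-v) τ.frame : Fin (k + 1) → E n) = (fun j => frameMap ρ.frame (f j)) ∧
      ρ.region = (fun x => y + frameMap f x) '' τ.prismRegion ∧ (frameMatrix f).det ≠ 0 := by
  have hρ' := hρ.trans (orbit_eq_image τ v)
  obtain ⟨y, f, hy, hf⟩ := ρ.exists_lift_affine τ.isOpenCell_prismRegion.isOpen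
    τ.isOpenCell_prismRegion.2.1 (τ.base + v) (Fin.cons (-v) τ.frame : Fin (k + 1) → E n)
    fun x hx => by
      have h1 : τ.base + v + frameMap (Fin.cons (-v) τ.frame : Fin (k + 1) → E n) x ∈
        ρ.carrier := by rw [hρ']; exact ⟨x, hx, rfl⟩
      exact Set.mem_range_of_mem_image _ _ h1
  have hF := funext hf
  have hreg : ρ.region = (fun x => y + frameMap f x) '' τ.prismRegion := by
    refine ρ.isometry_param.injective.image_injective ?_
    rw [Set.image_image]
    refine hρ'.trans (Set.image_congr fun x _ => ?_)
    rw [ρ.param_add_frameMap, ← hy, hF]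
  refine ⟨y, f, hy, hF, hreg, fun h0 => ρ.isOpenCell.volume_pos.ne' ?_⟩
  rw [hreg, volume_image_affine, h0]
  simp

/-- The arbitrary choice of the cell disappears: the orientation sign times the Jacobian `|det|` is
the determinant by which the form scales. In the degenerate case both sides vanish, since a form is
zero on dependent vectors. -/
lemma formalIntegral_prism_eq_setIntegral (τ : Cell n k) (v : E n)
    (ω : E n → E n [⋀^Fin (k + 1)]→L[ℝ] ℝ) :
    formalIntegral ω (prism τ v) = ∫ x in τ.prismRegion,
      ω (τ.base + v + frameMap (Fin.cons (-v) τ.frame : Fin (k + 1) → E n) x)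
        (Fin.cons (-v) τ.frame) := by
  by_cases h : ∃ ρ : Cell n (k + 1), ρ.carrier = orbit τ v
  · rw [prism, dif_pos h]
    obtain ⟨y, f, hy, hF, hreg, hdet⟩ := exists_prism_coordinates h.choose_spec
    set ρ := h.choose
    rw [hF, relSign_frameMap ρ.orthonormal, map_zsmul, formalIntegral_single, zsmul_eq_mul,
      Cell.integral, hreg, setIntegral_image_affine y f hdet
      τ.isOpenCell_prismRegion.isOpen.measurableSet, ← mul_assoc, ← integral_const_mul]
    refine integral_congr_ae (Eventually.of_forall fun x => ?_)
    simp only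
    rw [map_frameMap_eq_det_mul, ρ.param_add_frameMap, hy]
    congr 1
    rcases lt_or_gt_of_ne hdet with h0 | h0
    · simp [sign_neg h0, abs_of_neg h0]
    · simp [sign_pos h0, abs_of_pos h0]
  · rw [prism, dif_neg h, map_zero]
    have hli : ¬LinearIndependent ℝ (Fin.cons (-v) τ.frame : Fin (k + 1) → E n) :=
      fun hli => h (exists_carrier_eq_orbit τ v hli)
    have h0 : ∀ x, ω x (Fin.cons (-v) τ.frame) = 0 := fun x =>
      (ω x).toAlternatingMap.map_linearDependent _ hli
    simp [h0]

/-- The Hadamard inequality. -/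
lemma abs_det_frameMatrix_le {m : ℕ} (f : Fin m → E m) :
    |(frameMatrix f).det| ≤ ∏ i, ‖f i‖ := by
  have : Fact (Module.finrank ℝ (E m) = m) := ⟨finrank_euclideanSpace_fin⟩
  let b := EuclideanSpace.basisFun (Fin m) ℝ
  have h := b.toBasis.orientation.abs_volumeForm_apply_le f
  rw [b.toBasis.orientation.volumeForm_robust b rfl, Module.Basis.det_apply] at h
  exact h

/-- The Jacobian of the prism is bounded by Hadamard: its columns have the lengths of `-v` and of
the unit vectors of the frame. -/
lemma weightedNorm_prism_le (τ : Cell n k) (v : E n) :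
    weightedNorm Cell.mass (prism τ v) ≤ τ.mass * ‖v‖ := by
  by_cases h : ∃ ρ : Cell n (k + 1), ρ.carrier = orbit τ v
  · rw [prism, dif_pos h]
    obtain ⟨y, f, hy, hF, hreg, hdet⟩ := exists_prism_coordinates h.choose_spec
    set ρ := h.choose
    have hmass : ρ.mass ≤ τ.mass * ‖v‖ := by
      have hprod : ∏ i, ‖f i‖ = ‖v‖ := by
        have h1 : ∀ i, ‖f i‖ = ‖(Fin.cons (-v) τ.frame : Fin (k + 1) → E n) i‖ := fun i => by
          rw [hF, norm_frameMap ρ.orthonormal]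
        simp_rw [h1]
        rw [Fin.prod_univ_succ]
        simp [τ.orthonormal.1]
      rw [Cell.mass, hreg, volume_image_affine, τ.volume_prismRegion, ENNReal.toReal_mul,
        ENNReal.toReal_ofReal (abs_nonneg _), mul_comm]
      refine mul_le_mul_of_nonneg_left ?_ ENNReal.toReal_nonneg
      rw [← hprod]
      exact abs_det_frameMatrix_le f
    set z := relSign ρ.frame (Fin.cons (-v) τ.frame) with hz
    have hz1 : |(z : ℝ)| ≤ 1 := by
      rw [hz, relSign]
      rcases SignType.trichotomy (SignType.sign (Matrix.of fun i j => ⟪ρ.frame i,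
        (Fin.cons (-v) τ.frame : Fin (k + 1) → E n) j⟫).det) with h | h | h <;> rw [h] <;> simp
    have hsingle : z • single ρ = Finsupp.single ρ z := by simp [single]
    rw [hsingle, weightedNorm, Finsupp.sum_single_index (by simp)]
    exact (mul_le_of_le_one_left ρ.mass_nonneg hz1).trans hmass
  · rw [prism, dif_neg h, weightedNorm_zero]
    exact mul_nonneg τ.mass_nonneg (norm_nonneg v)

end prism

/-! ### The homotopy formula -/

/-! ### Iterated integrals over an interval and a bounded region -/

section iterated

variable {k : ℕ} {G : ℝ → E k → ℝ} {U : Set (E k)}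

lemma integrable_prod_of_continuous (hG : Continuous fun p : ℝ × E k => G p.1 p.2)
    (hU : Bornology.IsBounded U) (a b : ℝ) :
    Integrable (fun p : ℝ × E k => G p.1 p.2)
      ((volume.restrict (Set.uIoc a b)).prod (volume.restrict U)) := by
  rw [Measure.prod_restrict, ← Measure.volume_eq_prod]
  obtain ⟨R, hR⟩ := hU.subset_closedBall 0
  exact (hG.continuousOn.integrableOn_compact
    ((isCompact_uIcc (a := a) (b := b)).prod (isCompact_closedBall 0 R))).mono_set
    (Set.prod_mono Set.uIoc_subset_uIcc hR)

lemma integrableOn_slice (hG : Continuous fun p : ℝ × E k => G p.1 p.2)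
    (hU : Bornology.IsBounded U) (t : ℝ) : IntegrableOn (G t) U := by
  obtain ⟨R, hR⟩ := hU.subset_closedBall 0
  have : Continuous (G t) := hG.comp (Continuous.prodMk_right t)
  exact (this.continuousOn.integrableOn_compact (isCompact_closedBall 0 R)).mono_set hR

lemma intervalIntegrable_setIntegral (hG : Continuous fun p : ℝ × E k => G p.1 p.2)
    (hU : Bornology.IsBounded U) (a b : ℝ) :
    IntervalIntegrable (fun t => ∫ s in U, G t s) volume a b := by
  rw [intervalIntegrable_iff]
  exact (integrable_prod_of_continuous hG hU a b).integral_prod_left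

lemma intervalIntegral_setIntegral_swap (hG : Continuous fun p : ℝ × E k => G p.1 p.2)
    (hU : Bornology.IsBounded U) :
    ∫ t in (0 : ℝ)..1, ∫ s in U, G t s = ∫ s in U, ∫ t in (0 : ℝ)..1, G t s := by
  have h := integrable_prod_of_continuous hG hU 0 1
  rw [Set.uIoc_of_le zero_le_one] at h
  simp_rw [intervalIntegral.integral_of_le (zero_le_one' ℝ)]
  exact integral_integral_swap h

end iterated

section homotopy

variable {n k : ℕ}

lemma Cell.continuous_param (σ : Cell n k) : Continuous σ.param := σ.isometry_param.continuous

lemma continuous_form_apply {ω : E n → E n [⋀^Fin k]→L[ℝ] ℝ} (hω : Continuous ω)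
    (m : Fin k → E n) : Continuous fun x => ω x m :=
  (ContinuousAlternatingMap.apply ℝ (E n) ℝ m).continuous.comp hω

lemma Cell.continuous_slide (σ : Cell n k) (v : E n) :
    Continuous fun p : ℝ × E k => σ.param p.2 + p.1 • v :=
  (σ.continuous_param.comp continuous_snd).add (continuous_fst.smul continuous_const)

/-- Integration over a prism. -/
lemma formalIntegral_prism (τ : Cell n k) (v : E n) {ω : E n → E n [⋀^Fin (k + 1)]→L[ℝ] ℝ}
    (hω : Continuous ω) :
    formalIntegral ω (prism τ v) = ∫ t in (0 : ℝ)..1, ∫ s in τ.region,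
      ω (τ.param s + t • v) (Fin.cons (-v) τ.frame) := by
  set G : ℝ → E k → ℝ := fun t s => ω (τ.param s + t • v) (Fin.cons (-v) τ.frame) with hG
  have hGc : Continuous fun p : ℝ × E k => G p.1 p.2 :=
    (continuous_form_apply hω _).comp (τ.continuous_slide v)
  have hGc' : Continuous fun p : ℝ × E k => G (1 - p.1) p.2 :=
    hGc.comp ((continuous_const.sub continuous_fst).prodMk continuous_snd)
  rw [formalIntegral_prism_eq_setIntegral, τ.prismRegion_eq,
    (consEquiv_measurePreserving k).setIntegral_image_emb (consEquiv k).measurableEmbedding]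
  simp_rw [consEquiv_apply, prismParam_consE]
  -- The parametrization runs backwards, so t is replaced by 1 - t.
  have h1 := intervalIntegral.integral_comp_sub_left (a := 0) (b := 1)
    (fun t => ∫ s in τ.region, G t s) 1
  rw [sub_self, sub_zero] at h1
  rw [← h1, intervalIntegral.integral_of_le zero_le_one, integral_Ioc_eq_integral_Ioo]
  refine setIntegral_prod (fun p : ℝ × E k => G (1 - p.1) p.2) ?_
  have h2 := integrable_prod_of_continuous (G := fun t s => G (1 - t) s) hGc' τ.isOpenCell.2.2 0 1
  rw [Measure.prod_restrict, Set.uIoc_of_le zero_le_one] at h2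
  exact IntegrableOn.mono_set h2 (Set.prod_mono Set.Ioo_subset_Ioc_self subset_rfl)

/-- The prisms over a formal sum of cells. -/
noncomputable def prismChain (v : E n) : FormalChain n k →+ FormalChain n (k + 1) :=
  linearize fun τ => prism τ v

/-- Forming prisms is dual to contracting with `-v` and averaging over the translates. In this form
Stokes can be applied to the boundary of a cell at each fixed time t. -/
lemma formalIntegral_prismChain (v : E n) {ω : E n → E n [⋀^Fin (k + 1)]→L[ℝ] ℝ}
    (hω : Continuous ω) (S : FormalChain n k) :
    formalIntegral ω (prismChain v S) = ∫ t in (0 : ℝ)..1,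
      formalIntegral (fun x => (ω (x + t • v)).curryLeft (-v)) S := by
  -- Integrability is carried through the induction, since additivity of the integral needs it.
  suffices h : IntervalIntegrable
      (fun t => formalIntegral (fun x => (ω (x + t • v)).curryLeft (-v)) S) volume 0 1 ∧
      formalIntegral ω (prismChain v S) = ∫ t in (0 : ℝ)..1,
        formalIntegral (fun x => (ω (x + t • v)).curryLeft (-v)) S from h.2
  induction S using Finsupp.induction_linear with
  | zero => simp
  | add S T hS hT =>
    simp only [map_add]
    refine ⟨hS.1.add hT.1, ?_⟩
    rw [intervalIntegral.integral_add hS.1 hT.1, hS.2, hT.2]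
  | single τ z =>
    have hGc : Continuous fun p : ℝ × E k =>
        ω (τ.param p.2 + p.1 • v) (Fin.cons (-v) τ.frame) :=
      (continuous_form_apply hω _).comp (τ.continuous_slide v)
    have h1 : ∀ t : ℝ, formalIntegral (fun x => (ω (x + t • v)).curryLeft (-v))
        (Finsupp.single τ z) =
        z * ∫ s in τ.region, ω (τ.param s + t • v) (Fin.cons (-v) τ.frame) := fun t => by
      rw [formalIntegral, linearize_single, zsmul_eq_mul]
      rfl
    simp only [h1]
    refine ⟨(intervalIntegrable_setIntegral hGc τ.isOpenCell.2.2 0 1).const_mul _, ?_⟩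
    rw [intervalIntegral.integral_const_mul, prismChain, linearize_single, map_zsmul,
      formalIntegral_prism τ v hω, zsmul_eq_mul]

lemma formalIntegral_translateChain (u : E n) (ω : E n → E n [⋀^Fin k]→L[ℝ] ℝ)
    (S : FormalChain n k) :
    formalIntegral ω (translateChain u S) = formalIntegral (fun x => ω (x + u)) S := by
  have : (formalIntegral ω).comp (translateChain u) = formalIntegral (fun x => ω (x + u)) := by
    ext τ
    simp only [AddMonoidHom.comp_apply, Finsupp.singleAddHom_apply, translateChain,
      linearize_single, one_smul, formalIntegral_single]
    rw [formalIntegral, linearize_single, one_smul, Cell.integral, Cell.integral]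
    refine integral_congr_ae (Eventually.of_forall fun s => ?_)
    simp only [Cell.translate, Cell.param]
    rw [add_right_comm]
  exact DFunLike.congr_fun this S

lemma extDeriv_comp_add_right (ω : E n → E n [⋀^Fin k]→L[ℝ] ℝ) (u x : E n) :
    extDeriv (fun z => ω (z + u)) x = extDeriv ω (x + u) := by
  rw [extDeriv, extDeriv, fderiv_comp_add_right]

lemma fderiv_form_apply {ω : E n → E n [⋀^Fin k]→L[ℝ] ℝ} {x : E n}
    (hω : DifferentiableAt ℝ ω x) (w : E n) (m : Fin k → E n) :
    fderiv ℝ (fun z => ω z m) x w = fderiv ℝ ω x w m := by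
  have := ((ContinuousAlternatingMap.apply ℝ (E n) ℝ m).hasFDerivAt.comp x hω.hasFDerivAt).fderiv
  exact congrArg (fun L : E n →L[ℝ] ℝ => L w) this

lemma removeNth_succ_cons (w : E n) (e : Fin (k + 1) → E n) (i : Fin (k + 1)) :
    i.succ.removeNth (Fin.cons w e : Fin (k + 2) → E n) = Fin.cons w (i.removeNth e) := by
  ext1 j
  refine Fin.cases ?_ (fun j => ?_) j <;> simp [Fin.removeNth]

lemma contDiff_curryLeft {ω : E n → E n [⋀^Fin (k + 1)]→L[ℝ] ℝ} (hω : ContDiff ℝ 1 ω)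
    (w : E n) : ContDiff ℝ 1 fun x => (ω x).curryLeft w :=
  (ContinuousAlternatingMap.curryLeftLI.toContinuousLinearMap.contDiff.comp hω).clm_apply
    contDiff_const

/-- **The Cartan formula** for a constant vector field. -/
lemma fderiv_eq_extDeriv_add_extDeriv_curryLeft {ω : E n → E n [⋀^Fin (k + 1)]→L[ℝ] ℝ}
    (hω : ContDiff ℝ 1 ω) (x w : E n) (e : Fin (k + 1) → E n) :
    fderiv ℝ ω x w e =
      extDeriv ω x (Fin.cons w e) + extDeriv (fun z => (ω z).curryLeft w) x e := by
  have hω' := hω.differentiable one_ne_zero x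
  rw [extDeriv_apply hω', extDeriv_apply ((contDiff_curryLeft hω w).differentiable one_ne_zero x),
    Fin.sum_univ_succ]
  -- The zeroth term of `dω(w, e)` is the derivative along `w`. The others have the sign opposite to
  -- those of the differential of the contraction and cancel.
  simp only [removeNth_succ_cons, Fin.cons_zero, Fin.cons_succ, Fin.val_zero, pow_zero, one_smul,
    Fin.removeNth_zero, Fin.tail_cons, Fin.val_succ, pow_succ,
    ContinuousAlternatingMap.curryLeft_apply_apply, fderiv_form_apply hω']
  simp [Matrix.vecCons]

/-- The Cartan formula in degree 0, where there is no contraction term; correspondingly a point has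
no boundary term in the homotopy formula. -/
lemma fderiv_eq_extDeriv_of_zero {ω : E n → E n [⋀^Fin 0]→L[ℝ] ℝ} {x : E n}
    (hω : DifferentiableAt ℝ ω x) (w : E n) (e : Fin 0 → E n) :
    fderiv ℝ ω x w e = extDeriv ω x (Fin.cons w e) := by
  rw [extDeriv_apply hω]
  simp [fderiv_form_apply hω]

lemma contDiff_extDeriv {ω : E n → E n [⋀^Fin k]→L[ℝ] ℝ}
    (hω : ContDiff ℝ 2 ω) : ContDiff ℝ 1 (extDeriv ω) := by
  have h1 : ContDiff ℝ 1 (fderiv ℝ ω) := hω.fderiv_right (by norm_num)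
  exact (ContinuousAlternatingMap.alternatizeUncurryFinCLM ℝ (E n) ℝ).contDiff.comp h1

/-- The fundamental theorem of calculus for the translates of a cell. -/
lemma integral_sub_integral_translate (σ : Cell n k) (v : E n)
    {ω : E n → E n [⋀^Fin k]→L[ℝ] ℝ} (hω : ContDiff ℝ 1 ω) :
    σ.integral ω - (σ.translate v).integral ω = ∫ t in (0 : ℝ)..1, ∫ s in σ.region,
      fderiv ℝ ω (σ.param s + t • v) (-v) σ.frame := by
  have hD : ∀ x, HasFDerivAt ω (fderiv ℝ ω x) x := fun x =>
    (hω.differentiable one_ne_zero x).hasFDerivAt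
  have hDc : ∀ w, Continuous fun x => fderiv ℝ ω x w := fun w =>
    (hω.continuous_fderiv one_ne_zero).clm_apply continuous_const
  have hGc : Continuous fun p : ℝ × E k =>
      fderiv ℝ ω (σ.param p.2 + p.1 • v) (-v) σ.frame :=
    (continuous_form_apply (hDc (-v)) σ.frame).comp (σ.continuous_slide v)
  -- With t as the inner variable, the fundamental theorem applies along each segment from a point
  -- of `σ` to its translate.
  rw [intervalIntegral_setIntegral_swap
    (G := fun t s => fderiv ℝ ω (σ.param s + t • v) (-v) σ.frame) hGc σ.isOpenCell.2.2]
  have hpt : ∀ s, ∫ t in (0 : ℝ)..1, fderiv ℝ ω (σ.param s + t • v) (-v) σ.frame =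
      ω (σ.param s) σ.frame - ω (σ.param s + v) σ.frame := by
    intro s
    have hder : ∀ t : ℝ, HasDerivAt (fun t : ℝ => -ω (σ.param s + t • v) σ.frame)
        (fderiv ℝ ω (σ.param s + t • v) (-v) σ.frame) t := by
      intro t
      have h1 : HasDerivAt (fun t : ℝ => σ.param s + t • v) v t := by
        simpa using ((hasDerivAt_id t).smul_const v).const_add (σ.param s)
      have h2 := ((ContinuousAlternatingMap.apply ℝ (E n) ℝ σ.frame).hasFDerivAt.comp_hasDerivAt t
        ((hD (σ.param s + t • v)).comp_hasDerivAt t h1)).neg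
      refine h2.congr_deriv ?_
      rw [map_neg]
      rfl
    rw [intervalIntegral.integral_eq_sub_of_hasDerivAt (fun t _ => hder t)]
    · simp only [one_smul, zero_smul, add_zero]
      ring
    · exact (hGc.comp (Continuous.prodMk_left s)).intervalIntegrable 0 1
  simp only [hpt]
  have htr : (σ.translate v).integral ω = ∫ s in σ.region, ω (σ.param s + v) σ.frame := by
    refine integral_congr_ae (Eventually.of_forall fun s => ?_)
    simp only [Cell.translate, Cell.param]
    rw [add_right_comm]
  rw [htr, Cell.integral, ← integral_sub]
  · exact integrableOn_slice (G := fun _ s => ω (σ.param s) σ.frame)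
      ((continuous_form_apply hω.continuous σ.frame).comp
        (σ.continuous_param.comp continuous_snd)) σ.isOpenCell.2.2 0
  · exact integrableOn_slice (G := fun _ s => ω (σ.param s + v) σ.frame)
      ((continuous_form_apply hω.continuous σ.frame).comp
        ((σ.continuous_param.comp continuous_snd).add continuous_const)) σ.isOpenCell.2.2 0

lemma toPoly_eq_iff {S T : FormalChain n k} :
    toPoly S = toPoly T ↔ ∀ ω : E n → E n [⋀^Fin k]→L[ℝ] ℝ,
      ContDiff ℝ ((⊤ : ℕ∞) : WithTop ℕ∞) ω → formalIntegral ω S = formalIntegral ω T := by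
  rw [← sub_eq_zero, ← map_sub]
  refine (QuotientAddGroup.eq_zero_iff _).trans (forall₂_congr fun ω _ => ?_)
  rw [map_sub, sub_eq_zero]

/-- The homotopy formula for the translation of a cell of positive dimension. -/
theorem toPoly_sub_translate (σ : Cell n (k + 1)) (v : E n) :
    toPoly (single σ - single (σ.translate v)) =
      toPoly (prismChain v (cellBoundary σ) + boundary (prism σ v)) := by
  refine toPoly_eq_iff.2 fun ω hω => ?_
  have hω1 : ContDiff ℝ 1 ω := hω.of_le (by norm_cast)
  have hω2 : ContDiff ℝ 2 ω := hω.of_le (by norm_cast)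
  have hd := (contDiff_extDeriv hω2).continuous
  have hDc : Continuous fun x => fderiv ℝ ω x (-v) :=
    (hω1.continuous_fderiv one_ne_zero).clm_apply continuous_const
  rw [map_sub, map_add, formalIntegral_single, formalIntegral_single,
    integral_sub_integral_translate σ v hω1, formalIntegral_boundary _ hω1,
    formalIntegral_prism σ v hd, formalIntegral_prismChain v hω.continuous]
  have hA : Continuous fun p : ℝ × E (k + 1) =>
      fderiv ℝ ω (σ.param p.2 + p.1 • v) (-v) σ.frame :=
    (continuous_form_apply hDc σ.frame).comp (σ.continuous_slide v)
  have hB : Continuous fun p : ℝ × E (k + 1) =>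
      extDeriv ω (σ.param p.2 + p.1 • v) (Fin.cons (-v) σ.frame) :=
    (continuous_form_apply hd _).comp (σ.continuous_slide v)
  -- At fixed t, Stokes turns the boundary integral into that of the differential of the
  -- contraction, and the Cartan formula expresses the latter through the other two terms.
  have hmid : ∀ t : ℝ, formalIntegral (fun x => (ω (x + t • v)).curryLeft (-v))
      (cellBoundary σ) = (∫ s in σ.region, fderiv ℝ ω (σ.param s + t • v) (-v) σ.frame) -
        ∫ s in σ.region, extDeriv ω (σ.param s + t • v) (Fin.cons (-v) σ.frame) := by
    intro t
    have hωt : ContDiff ℝ 1 fun x => ω (x + t • v) := hω1.comp (by fun_prop)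
    rw [formalIntegral_cellBoundary σ (contDiff_curryLeft hωt (-v)), Cell.integral, ← integral_sub
      (integrableOn_slice (G := fun t s => fderiv ℝ ω (σ.param s + t • v) (-v) σ.frame) hA
        σ.isOpenCell.2.2 t)
      (integrableOn_slice (G := fun t s => extDeriv ω (σ.param s + t • v) (Fin.cons (-v) σ.frame))
        hB σ.isOpenCell.2.2 t)]
    refine integral_congr_ae (Eventually.of_forall fun s => ?_)
    have := fderiv_eq_extDeriv_add_extDeriv_curryLeft hωt (σ.param s) (-v) σ.frame
    rw [fderiv_comp_add_right, extDeriv_comp_add_right] at this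
    simp only
    rw [this]
    ring
  simp only [hmid]
  rw [intervalIntegral.integral_sub (intervalIntegrable_setIntegral hA σ.isOpenCell.2.2 0 1)
    (intervalIntegrable_setIntegral hB σ.isOpenCell.2.2 0 1)]
  ring

/-- The homotopy formula for the translation of a point. -/
theorem toPoly_sub_translate_of_zero (σ : Cell n 0) (v : E n) :
    toPoly (single σ - single (σ.translate v)) = toPoly (boundary (prism σ v)) := by
  refine toPoly_eq_iff.2 fun ω hω => ?_
  have hω1 : ContDiff ℝ 1 ω := hω.of_le (by norm_cast)
  have hω2 : ContDiff ℝ 2 ω := hω.of_le (by norm_cast)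
  rw [map_sub, formalIntegral_single, formalIntegral_single,
    integral_sub_integral_translate σ v hω1, formalIntegral_boundary _ hω1,
    formalIntegral_prism σ v (contDiff_extDeriv hω2).continuous]
  simp only [fderiv_eq_extDeriv_of_zero (hω1.differentiable one_ne_zero _)]

/-- A prism is cut into two halves. -/
theorem toPoly_prism_two_smul (τ : Cell n k) (u : E n) :
    toPoly (prism τ ((2 : ℝ) • u)) = toPoly (prism τ u + translateChain u (prism τ u)) := by
  refine toPoly_eq_iff.2 fun ω hω => ?_
  have hωc := hω.continuous
  have hωu : Continuous fun x => ω (x + u) := hωc.comp (by fun_prop)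
  rw [map_add, formalIntegral_translateChain, formalIntegral_prism _ _ hωc,
    formalIntegral_prism _ _ hωc, formalIntegral_prism _ _ hωu]
  set K : ℝ → ℝ := fun t => ∫ s in τ.region, ω (τ.param s + t • u) (Fin.cons (-u) τ.frame) with hK
  have hKi : ∀ a b : ℝ, IntervalIntegrable K volume a b :=
    intervalIntegrable_setIntegral
      (G := fun t s => ω (τ.param s + t • u) (Fin.cons (-u) τ.frame))
      ((continuous_form_apply hωc _).comp (τ.continuous_slide u)) τ.isOpenCell.2.2
  -- This factor 2 is the Jacobian of t ↦ 2t, so the long prism is the integral of `K` over [0, 2];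
  -- the two short ones account for [0, 1] and [1, 2].
  have h2 : ∀ x, ω x (Fin.cons (-((2 : ℝ) • u)) τ.frame) = 2 * ω x (Fin.cons (-u) τ.frame) := by
    intro x
    have h1 : (ω x).curryLeft ((2 : ℝ) • -u) τ.frame = 2 * (ω x).curryLeft (-u) τ.frame := by
      rw [map_smul]
      rfl
    rw [← smul_neg]
    exact h1
  have e1 : ∫ t in (0 : ℝ)..1, ∫ s in τ.region,
      ω (τ.param s + t • (2 : ℝ) • u) (Fin.cons (-((2 : ℝ) • u)) τ.frame) =
      ∫ t in (0 : ℝ)..2, K t := by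
    have h3 := intervalIntegral.mul_integral_comp_mul_right (a := 0) (b := 1) (f := K) 2
    rw [zero_mul, one_mul] at h3
    rw [← h3, ← intervalIntegral.integral_const_mul]
    refine intervalIntegral.integral_congr fun t _ => ?_
    simp only [hK, h2, smul_smul, integral_const_mul]
  have e2 : ∫ t in (0 : ℝ)..1, ∫ s in τ.region,
      ω (τ.param s + t • u + u) (Fin.cons (-u) τ.frame) = ∫ t in (1 : ℝ)..2, K t := by
    have h3 := intervalIntegral.integral_comp_add_right (a := 0) (b := 1) K 1
    rw [zero_add, one_add_one_eq_two] at h3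
    rw [← h3]
    refine intervalIntegral.integral_congr fun t _ => ?_
    simp only [hK, add_smul, one_smul, add_assoc]
  rw [e1, e2, intervalIntegral.integral_add_adjacent_intervals (hKi _ _) (hKi _ _)]

end homotopy

/-! ### Convergence -/

section convergence

variable {n k : ℕ}

/-- The difference of a chain and its translate is small in the natural norms. -/
lemma natNorm_sub_translateChain_le (r : ℕ) (S : FormalChain n k) (w : E n) :
    natNorm (r + 1) (toPoly (S - translateChain w S)) ≤ weightedNorm Cell.mass S * ‖w‖ := by
  have hinj : Function.Injective (fun σ : Cell n k => (⟨σ, fun _ => w⟩ : Multicell n k 1)) :=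
    fun a b h => by simpa using h
  set M : MultiChain n k 1 :=
    Finsupp.mapDomain (fun σ => (⟨σ, fun _ => w⟩ : Multicell n k 1)) S with hM
  have hpoly : M.toPoly = toPoly (S - translateChain w S) := by
    have hlin : (linearize fun m : Multicell n k 1 => multicellChain m.cell m.vec).comp
        (Finsupp.mapDomain.addMonoidHom fun σ => (⟨σ, fun _ => w⟩ : Multicell n k 1)) =
        AddMonoidHom.id _ - translateChain w := by
      ext1 σ
      ext1
      simp [linearize_single, multicellChain, translateChain, single]
    exact congrArg toPoly (DFunLike.congr_fun hlin S)
  have hnorm : M.norm = weightedNorm Cell.mass S * ‖w‖ := by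
    rw [MultiChain.norm, weightedNorm, hM, Finsupp.sum_mapDomain_index_inj hinj, weightedNorm,
      Finsupp.sum, Finsupp.sum, Finset.sum_mul]
    refine Finset.sum_congr rfl fun σ _ => ?_
    simp [Multicell.norm, mul_assoc]
  -- The decomposition that uses only 2¹-multicells: `M` in slot 1, zero elsewhere, and C = 0.
  let S' : ∀ j : Fin (r + 2), MultiChain n k j := fun j =>
    Fin.cons (α := fun j : Fin (r + 2) => MultiChain n k j) 0
      (Fin.cons (α := fun j : Fin (r + 1) => MultiChain n k (j.succ : Fin (r + 2))) M
        fun _ => 0) j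
  have hS'poly : ∑ j, (S' j).toPoly = M.toPoly := by
    rw [Fin.sum_univ_succ, Fin.sum_univ_succ]
    change MultiChain.toPoly (0 : MultiChain n k 0) + (M.toPoly +
      ∑ i : Fin r, MultiChain.toPoly (0 : MultiChain n k (i.succ.succ : Fin (r + 2)))) = _
    simp
  have hS'norm : ∑ j, (S' j).norm = M.norm := by
    rw [Fin.sum_univ_succ, Fin.sum_univ_succ]
    change MultiChain.norm (0 : MultiChain n k 0) + (M.norm +
      ∑ i : Fin r, MultiChain.norm (0 : MultiChain n k (i.succ.succ : Fin (r + 2)))) = _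
    simp [MultiChain.norm]
  have h := natNorm_succ_le S' 0 (toPoly (S - translateChain w S))
    (by rw [hS'poly, hpoly]; simp)
  rwa [hS'norm, hnorm, map_zero, natNorm_zero, add_zero] at h

/-- Halving the prism leaves a difference of translates, which gains a second factor `‖u‖` beyond
the one in the mass of the prism; this beats the factor `2 ^ j`. The bound is written in the shape
`C / 2 / 2 ^ j` required by the geometric Cauchy criterion. -/
lemma dist_massSeq_le (v : E n) (τ : Cell n k) (j : ℕ) :
    dist (massSeq v τ j) (massSeq v τ (j + 1)) ≤ τ.mass * ‖v‖ ^ 2 / 2 / 2 / 2 ^ j := by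
  set u : E n := ((2 : ℝ) ^ (j + 1))⁻¹ • v with hu
  have h2u : ((2 : ℝ) ^ j)⁻¹ • v = (2 : ℝ) • u := by
    rw [hu, smul_smul, pow_succ, mul_inv_rev, ← mul_assoc, mul_inv_cancel₀ two_ne_zero, one_mul]
  -- With P the prism along u, this is 2ʲ⁺¹ P - 2ʲ (P + T_u P) = 2ʲ (P - T_u P).
  have hpoly : toPoly ((2 ^ (j + 1) : ℤ) • prism τ u - (2 ^ j : ℤ) • prism τ ((2 : ℝ) • u)) =
      toPoly (((2 ^ j : ℤ) • prism τ u) - translateChain u ((2 ^ j : ℤ) • prism τ u)) := by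
    simp only [map_sub, map_zsmul, toPoly_prism_two_smul, map_add]
    generalize toPoly (prism τ u) = P
    generalize toPoly (translateChain u (prism τ u)) = Q
    rw [zsmul_add, pow_succ, mul_two, add_zsmul]
    abel
  have hnorm : dist (massSeq v τ j) (massSeq v τ (j + 1)) =
      natNorm 1 (toPoly ((2 ^ (j + 1) : ℤ) • prism τ u - (2 ^ j : ℤ) • prism τ ((2 : ℝ) • u))) := by
    rw [dist_comm, dist_eq_norm, massSeq, massSeq, h2u, ← map_sub, norm_toChainlet]
  rw [hnorm, hpoly]
  refine (natNorm_sub_translateChain_le 0 _ u).trans ?_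
  have hw : weightedNorm Cell.mass ((2 ^ j : ℤ) • prism τ u) ≤ 2 ^ j * (τ.mass * ‖u‖) := by
    have : weightedNorm Cell.mass ((2 ^ j : ℤ) • prism τ u) =
        2 ^ j * weightedNorm Cell.mass (prism τ u) := by
      rw [weightedNorm, Finsupp.sum_smul_index (by simp), weightedNorm, Finsupp.mul_sum]
      refine Finsupp.sum_congr fun a _ => ?_
      push_cast
      rw [abs_mul, abs_of_pos (by positivity), mul_assoc]
    rw [this]
    exact mul_le_mul_of_nonneg_left (weightedNorm_prism_le τ u) (by positivity)
  refine (mul_le_mul_of_nonneg_right hw (norm_nonneg u)).trans (le_of_eq ?_)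
  rw [hu, norm_smul, norm_inv, norm_pow, Real.norm_two]
  field_simp
  ring

/-- The directional mass cells exist. -/
theorem tendsto_massSeq (v : E n) (τ : Cell n k) :
    Tendsto (massSeq v τ) atTop (𝓝 (massCell v τ)) :=
  (cauchySeq_of_le_geometric_two (dist_massSeq_le v τ)).tendsto_limUnder

lemma tendsto_linearize_massSeq (v : E n) (S : FormalChain n k) :
    Tendsto (fun j => linearize (fun τ => massSeq v τ j) S) atTop (𝓝 (massChain v S)) := by
  simp only [massChain, linearize, Finsupp.liftAddHom_apply, Finsupp.sum]
  exact tendsto_finsetSum _ fun τ _ => (tendsto_massSeq v τ).const_smul (S τ)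

lemma linearize_massSeq (v : E n) (S : FormalChain n k) (j : ℕ) :
    linearize (fun τ => massSeq v τ j) S =
      toChainlet 1 ((2 ^ j : ℤ) • prismChain ((2 ^ j : ℝ)⁻¹ • v) S) := by
  have : linearize (fun τ => massSeq v τ j) =
      (toChainlet 1).comp ((2 ^ j : ℤ) • prismChain (k := k) ((2 ^ j : ℝ)⁻¹ • v)) := by
    ext1 τ
    ext1
    simp only [AddMonoidHom.comp_apply, Finsupp.singleAddHom_apply, linearize_single,
      AddMonoidHom.smul_apply, prismChain, one_smul]
    rfl
  exact DFunLike.congr_fun this S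

lemma continuous_extendToChainlets {r l s : ℕ} (f : FormalChain n k →+ Chainlet n l s)
    (hf : ∀ S, ‖f S‖ ≤ natNorm r (toPoly S)) : Continuous (extendToChainlets f hf) :=
  NormedAddGroupHom.continuous (NormedAddGroupHom.extension _)

lemma extendToChainlets_toChainlet {r l s : ℕ} (f : FormalChain n k →+ Chainlet n l s)
    (hf : ∀ S, ‖f S‖ ≤ natNorm r (toPoly S)) (S : FormalChain n k) :
    extendToChainlets f hf (toChainlet r S) = f S :=
  NormedAddGroupHom.extension_coe _ _

lemma toChainlet_eq_of_toPoly_eq (r : ℕ) {S T : FormalChain n k} (h : toPoly S = toPoly T) :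
    toChainlet r S = toChainlet r T :=
  congrArg (UniformSpace.Completion.toCompl (α := NormedChain n k r)) h

lemma chainletBoundary_massSeq (v : E n) (σ : Cell n k) (j : ℕ) :
    chainletBoundary 1 (massSeq v σ j) =
      toChainlet 2 ((2 ^ j : ℤ) • boundary (prism σ ((2 ^ j : ℝ)⁻¹ • v))) := by
  rw [massSeq, chainletBoundary, extendToChainlets_toChainlet, AddMonoidHom.comp_apply,
    map_zsmul boundary]

/-- For every j the homotopy formula, applied to 2⁻ʲv and multiplied by 2ʲ, is an exact identity;
only continuity of the inclusion and of ∂ is needed to pass to the limit. Class 2 appears because ∂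
raises the class of mass cells by one. -/
lemma tendsto_lieSeq (v : E n) (σ : Cell n k) :
    Tendsto (lieSeq v σ) atTop
      (𝓝 (chainletInclusion 1 (massBoundary v σ) + chainletBoundary 1 (massCell v σ))) := by
  have hb : Tendsto (fun j => chainletBoundary 1 (massSeq v σ j)) atTop
      (𝓝 (chainletBoundary 1 (massCell v σ))) :=
    ((continuous_extendToChainlets _ _).tendsto _).comp (tendsto_massSeq v σ)
  cases k with
  | zero =>
    rw [massBoundary, map_zero, zero_add]
    refine hb.congr fun j => ?_
    rw [chainletBoundary_massSeq, lieSeq]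
    refine toChainlet_eq_of_toPoly_eq 2 ?_
    rw [map_zsmul, map_zsmul, toPoly_sub_translate_of_zero]
  | succ k =>
    have hi : Tendsto (fun j => chainletInclusion 1
        (linearize (fun τ => massSeq v τ j) (cellBoundary σ))) atTop
        (𝓝 (chainletInclusion 1 (massBoundary v σ))) :=
      ((continuous_extendToChainlets _ _).tendsto _).comp
        (tendsto_linearize_massSeq v (cellBoundary σ))
    refine (hi.add hb).congr fun j => ?_
    rw [chainletBoundary_massSeq, linearize_massSeq, chainletInclusion,
      extendToChainlets_toChainlet, ← map_add, ← smul_add, lieSeq]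
    refine toChainlet_eq_of_toPoly_eq 2 ?_
    rw [map_zsmul, map_zsmul, toPoly_sub_translate]

end convergence

end Chainlets

theorem mainTheorem1 {n k : ℕ} (σ : Chainlets.Cell n k) (v : Chainlets.E n) :
    (∀ (l : ℕ) (τ : Chainlets.Cell n l),
      Filter.Tendsto (Chainlets.massSeq v τ) Filter.atTop (nhds (Chainlets.massCell v τ))) ∧
    Filter.Tendsto (Chainlets.lieSeq v σ) Filter.atTop (nhds (Chainlets.lieDerivative v σ)) ∧
    Chainlets.lieDerivative v σ =
      Chainlets.chainletInclusion 1 (Chainlets.massBoundary v σ) +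
        Chainlets.chainletBoundary 1 (Chainlets.massCell v σ) := by
  have h := Chainlets.tendsto_lieSeq v σ
  -- The Lie derivative is defined as a limit by choice; uniqueness of limits in the completion
  -- identifies it with the limit already found.
  have hlim := h.limUnder_eq
  exact ⟨fun l τ => Chainlets.tendsto_massSeq v τ, by rw [Chainlets.lieDerivative, hlim]; exact h,
    hlim⟩
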